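/- A cube complex is a set $X$ of vertices together with a collection of finite subsets, called cubes, such that every singleton is a cube, the intersection of two cubes is empty or a cube, and every cube $C$ admits a bijection with the vertices of a standard cube $[0,1]^n$ under which the cubes contained in $C$ correspond precisely to the vertex sets of the (nonempty) faces. Edges and squares are the cubes with $2$ and $4$ elements. The complex is $CAT(0)$ if its geometric realization (unit Euclidean cubes glued along common faces), with the length metric, is a $CAT(0)$ metric space. The distance $d(x,y)$ of vertices is the least length of an edge-path from $x$ to $y$. A hyperplane is an equivalence class of edges under the equivalence relation generated by $\{x,y\}\sim\{x',y'\}$ whenever $\{x,x',y,y'\}$ is a square. Let $X$ be a $CAT(0)$ cube complex, of finite or infinite dimension, and let a discrete group $G$ act on the set $X$ of vertices so that cubes are mapped to cubes. Let $\pi$ be the permutation representation on $\ell^2(X)$, $\pi(g)\delta_v=\delta_{gv}$. Let $\mathbb D$ be the open unit disk and let $z\mapsto w$ be a holomorphic function on $\mathbb D$ with $z^2+w^2=1$. For adjacent vertices $x,y$ let $H$ be the hyperplane of the edge $\{x,y\}$ and let $H_+$ (resp. $H_-$) be the set of vertices joined to $x$ (resp. $y$) by an edge-path that does not cross $H$.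 Then: 1. For all $z\in\mathbb D$ and all adjacent $x,y$ there is exactly one bounded operator $c_z(x,y)$ on $\ell^2(X)$ such that $c_z(x,y)\delta_v = w\delta_v - z\delta_{v^{\rm op}}$ if $v\in H_+$ is adjacent to $H$, $c_z(x,y)\delta_v = w\delta_v + z\delta_{v^{\rm op}}$ if $v\in H_-$ is adjacent to $H$, and $c_z(x,y)\delta_v=\delta_v$ if $v$ is not adjacent to $H$. Here $v$ is adjacent to $H$ if it is a vertex of an edge $\{v,v^{\rm op}\}\in H$. 2. Any two vertices $x,y$ are joined by an edge-path $x=v_0,\dots,v_n=y$, and the product $c_z(x,y)=c_z(v_0,v_1)\cdots c_z(v_{n-1},v_n)$ does not depend on the path. 3. For every $z\in\mathbb D$, $c_z$ is a cocycle for $\pi$: $c_z(x,x)=1$, $c_z(v,x)c_z(x,y)=c_z(v,y)$ and $\pi(g)c_z(x,y)\pi(g)^{-1}=c_z(gx,gy)$ for all $v,x,y\in X$ and $g\in G$. 4. For every vertex $x$, the formula $\pi_z(g)=c_z(x,gx)\pi(g)$ defines, for each $z\in\mathbb D$, a representation of $G$ by bounded invertible operators on $\ell^2(X)$. These form a holomorphic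 family: for all $g\in G$ and $\xi,\xi'\in\ell^2(X)$ the function $z\mapsto\langle\pi_z(g)\xi,\xi'\rangle$ is holomorphic on $\mathbb D$. If $z\in\mathbb D$ is real, then $\pi_z$ is unitary. 5. $\langle\pi_z(g)\delta_x,\delta_x\rangle=z^{d(x,gx)}$ for all $z\in\mathbb D$, $x\in X$ and $g\in G$. -/

import Mathlib

open scoped ENNReal

noncomputable section

/-! ### Cube complexes -/

/-- `F` is the vertex set of a (nonempty) face of the standard cube `[0,1]^n`, whose vertices
are the `0/1`-vectors: some of the coordinates are prescribed, the others are free. -/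
def IsCubeFace {n : ℕ} (F : Set (Fin n → Bool)) : Prop :=
  ∃ (I : Set (Fin n)) (a : Fin n → Bool), F = {f | ∀ i ∈ I, f i = a i}

/-- `φ` is a bijection from the vertices of the standard `n`-cube onto `C` under which the members
of `cubes` contained in `C` are exactly the vertex sets of the faces of the standard cube. -/
structure IsCubeParam {V : Type*} (cubes : Set (Set V)) (C : Set V) {n : ℕ}
    (φ : (Fin n → Bool) → V) : Prop where
  injective : Function.Injective φ
  range_eq : Set.range φ = C
  mem_iff : ∀ D : Set V, D ⊆ C → (D ∈ cubes ↔ ∃ F, IsCubeFace F ∧ D = φ '' F)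

/-- A cube complex with vertex set `V`. Cubes are (automatically finite, nonempty) sets of
vertices. -/
structure CubeComplex (V : Type*) where
  cubes : Set (Set V)
  singleton_mem : ∀ v, {v} ∈ cubes
  inter_mem : ∀ C ∈ cubes, ∀ D ∈ cubes, (C ∩ D).Nonempty → C ∩ D ∈ cubes
  exists_param : ∀ C ∈ cubes, ∃ (n : ℕ) (φ : (Fin n → Bool) → V), IsCubeParam cubes C φ

/-- The point of the `n`-cube with vertices `φ f` that has coordinates `t ∈ [0,1]^n`, written as a
formal convex combination of vertices: the vertex `φ f` has the weight
`∏ i, (t i if f i = 1, and 1 - t i if f i = 0)`. The weights determine `t`; they vanish off a face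
that contains the point, and do not depend on the choice of `φ` up to symmetries of the cube. Thus
points of different cubes have the same weights exactly if they are the same point of a common
face. -/
def cubePoint {V : Type*} {n : ℕ} (φ : (Fin n → Bool) → V) (t : EuclideanSpace ℝ (Fin n)) :
    V →₀ ℝ :=
  ∑ f : Fin n → Bool, Finsupp.single (φ f) (∏ i, if f i then t i else 1 - t i)

/-- The standard unit cube in `ℝⁿ`. -/
def unitCube (n : ℕ) : Set (EuclideanSpace ℝ (Fin n)) := {t | ∀ i, 0 ≤ t i ∧ t i ≤ 1}

namespace CubeComplex

variable {V : Type*} (X : CubeComplex V)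

/-- The geometric realization: the disjoint union of unit cubes, one for each cube of `X`, glued
along their common faces. -/
def Realization : Type _ :=
  {m : V →₀ ℝ // ∃ C ∈ X.cubes, ∃ (n : ℕ) (φ : (Fin n → Bool) → V), IsCubeParam X.cubes C φ ∧
    ∃ t ∈ unitCube n, m = cubePoint φ t}

/-- `p` and `q` lie in a common cube, in which their Euclidean distance is `ℓ`. -/
def Step (p q : X.Realization) (ℓ : ℝ) : Prop :=
  ∃ C ∈ X.cubes, ∃ (n : ℕ) (φ : (Fin n → Bool) → V), IsCubeParam X.cubes C φ ∧
    ∃ s ∈ unitCube n, ∃ t ∈ unitCube n,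
      p.1 = cubePoint φ s ∧ q.1 = cubePoint φ t ∧ ℓ = dist s t

/-- There is a piecewise linear path from `p` to `q` of length `ℓ`: a finite string of points,
consecutive ones lying in a common cube. -/
inductive PLPath : X.Realization → X.Realization → ℝ → Prop
  | nil (p : X.Realization) : PLPath p p 0
  | cons {p q r : X.Realization} {a b : ℝ} (h : X.Step p q a) (h' : PLPath q r b) :
      PLPath p r (a + b)

variable {X}

theorem Step.symm {p q : X.Realization} {a : ℝ} (h : X.Step p q a) : X.Step q p a := by
  obtain ⟨C, hC, n, φ, hφ, s, hs, t, ht, h1, h2, h3⟩ := h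
  exact ⟨C, hC, n, φ, hφ, t, ht, s, hs, h2, h1, by rw [h3, dist_comm]⟩

theorem PLPath.trans {p q r : X.Realization} {a b : ℝ} (h : X.PLPath p q a)
    (h' : X.PLPath q r b) : X.PLPath p r (a + b) := by
  induction h with
  | nil p => simpa using h'
  | cons h1 _ ih => rw [add_assoc]; exact PLPath.cons h1 (ih h')

theorem PLPath.symm {p q : X.Realization} {a : ℝ} (h : X.PLPath p q a) : X.PLPath q p a := by
  induction h with
  | nil p => exact PLPath.nil p
  | cons h1 _ ih =>
    rw [add_comm]
    exact ih.trans (by simpa using PLPath.cons h1.symm (PLPath.nil _))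

variable (X)

/-- The length (pseudo-)metric of the realization: the infimum of the lengths of piecewise linear
paths (`∞` if there is none). -/
instance : PseudoEMetricSpace X.Realization where
  edist p q := ⨅ (ℓ : ℝ) (_ : X.PLPath p q ℓ), ENNReal.ofReal ℓ
  edist_self p := le_antisymm
    (iInf₂_le_of_le 0 (PLPath.nil p) (by simp)) bot_le
  edist_comm p q := le_antisymm
    (le_iInf₂ fun ℓ h => iInf₂_le ℓ h.symm) (le_iInf₂ fun ℓ h => iInf₂_le ℓ h.symm)
  edist_triangle p q r := by
    simp only [ENNReal.iInf_add, ENNReal.add_iInf]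
    exact le_iInf₂ fun a ha => le_iInf₂ fun b hb =>
      iInf₂_le_of_le _ (hb.trans ha)
        (ENNReal.ofReal_add_le.trans_eq (by ring))

end CubeComplex

/-- `E` is a `CAT(0)` metric space: a metric space (distances are finite and separate points) in
which any two points are joined by a geodesic, and in which every geodesic triangle `p, q, r` is at
least as thin as its comparison triangle `p', q', r'` in the Euclidean plane: for points `x` on a
side `[p,q]` and `y` on a side `[p,r]`, with comparison points `x'`, `y'`, one has
`d(x,y) ≤ d(x',y')`. (A point `x` lies on a geodesic from `p` to `q` iff
`d(p,x) + d(x,q) = d(p,q)`.) -/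
structure IsCAT0Space (E : Type*) [PseudoEMetricSpace E] : Prop where
  edist_ne_top : ∀ p q : E, edist p q ≠ ∞
  eq_of_edist_eq_zero : ∀ p q : E, edist p q = 0 → p = q
  exists_geodesic : ∀ p q : E, ∃ (L : ℝ) (γ : ℝ → E), 0 ≤ L ∧ γ 0 = p ∧ γ L = q ∧
    ∀ s ∈ Set.Icc 0 L, ∀ t ∈ Set.Icc 0 L, edist (γ s) (γ t) = ENNReal.ofReal |s - t|
  comparison : ∀ p q r x y : E,
    edist p x + edist x q = edist p q → edist p y + edist y r = edist p r →
    ∀ p' q' r' x' y' : EuclideanSpace ℝ (Fin 2),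
      edist p' q' = edist p q → edist p' r' = edist p r → edist q' r' = edist q r →
      edist p' x' = edist p x → edist x' q' = edist x q →
      edist p' y' = edist p y → edist y' r' = edist y r →
      edist x y ≤ edist x' y'

namespace CubeComplex

variable {V : Type*} (X : CubeComplex V)

/-- A `CAT(0)` cube complex: the geometric realization is a `CAT(0)` metric space. -/
def IsCAT0 : Prop := IsCAT0Space X.Realization

/-! ### Edges, hyperplanes, half-spaces -/

/-- The graph of vertices and edges (cubes with two elements). Edge-paths are its walks, and the
distance of vertices is its graph distance. -/
def graph : SimpleGraph V where
  Adj x y := x ≠ y ∧ {x, y} ∈ X.cubes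
  symm := ⟨fun x y h => ⟨h.1.symm, by rw [Set.pair_comm]; exact h.2⟩⟩
  loopless := ⟨fun _ h => h.1 rfl⟩

/-- The edges `e = {x,y}` and `f = {x',y'}` are such that `{x,x',y,y'}` is a square, i.e. a cube
with four elements. -/
def Opposite (e f : Sym2 V) : Prop :=
  ∃ x y x' y' : V, e = s(x, y) ∧ f = s(x', y') ∧ X.graph.Adj x y ∧ X.graph.Adj x' y' ∧
    {x, x', y, y'} ∈ X.cubes ∧ ({x, x', y, y'} : Set V).ncard = 4

/-- The hyperplane of the edge `{x,y}`: its class under the equivalence relation generated by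
`Opposite`, as a set of edges. -/
def hyperplane (x y : V) : Set (Sym2 V) := {f | Relation.EqvGen X.Opposite s(x, y) f}

/-- The side of `v` with respect to a hyperplane `H`: all vertices that are joined to `v` by an
edge-path that does not cross `H`. -/
def side (H : Set (Sym2 V)) (v : V) : Set V := {u | (X.graph.deleteEdges H).Reachable v u}

end CubeComplex

/-! ### Operators on `ℓ²(V)` -/

/-- The Hilbert space `ℓ²(V)`. -/
abbrev L2 (V : Type*) := lp (fun _ : V => ℂ) 2

/-- The Dirac function at `v`. -/
def delta {V : Type*} (v : V) : L2 V := by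
  classical exact lp.single 2 v (1 : ℂ)

theorem memlp_comp_equiv {V : Type*} (e : V ≃ V) (f : L2 V) :
    Memℓp (fun v => f (e v)) 2 := by
  have h := (memℓp_gen_iff (by norm_num)).1 (lp.memℓp f)
  exact (memℓp_gen_iff (by norm_num)).2 (e.summable_iff.2 h)

/-- The permutation representation of `G` on `ℓ²(V)`: `(π(g) f)(v) = f(g⁻¹ v)`, that is,
`π(g) δ_v = δ_{gv}`. -/
def permRep (G : Type*) {V : Type*} [Group G] [MulAction G V] : G →* (L2 V →L[ℂ] L2 V) where
  toFun g := LinearIsometry.toContinuousLinearMap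
    { toFun := fun f => ⟨fun v => f (g⁻¹ • v), memlp_comp_equiv (MulAction.toPerm g⁻¹) f⟩
      map_add' := fun _ _ => rfl
      map_smul' := fun _ _ => rfl
      norm_map' := fun f => by
        rw [lp.norm_eq_tsum_rpow (by norm_num), lp.norm_eq_tsum_rpow (by norm_num)]
        congr 1
        exact (MulAction.toPerm g⁻¹ : V ≃ V).tsum_eq
          (fun v => ‖(f : V → ℂ) v‖ ^ (2 : ℝ≥0∞).toReal) }
  map_one' := by
    ext f v
    change f ((1 : G)⁻¹ • v) = f v
    simp
  map_mul' g h := by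
    ext f v
    change f ((g * h)⁻¹ • v) = f (h⁻¹ • g⁻¹ • v)
    rw [mul_inv_rev, mul_smul]

/-- `c` is a cocycle for the permutation representation of `G` on `ℓ²(V)`. -/
structure IsCocycle (G : Type*) {V : Type*} [Group G] [MulAction G V]
    (c : V → V → (L2 V →L[ℂ] L2 V)) : Prop where
  self : ∀ x, c x x = 1
  mul : ∀ v x y, c v x * c x y = c v y
  equivariant : ∀ (g : G) (x y : V),
    permRep G g * c x y * permRep G g⁻¹ = c (g • x) (g • y)

/-- `ρ z`, for `z` in the open unit disk, is a holomorphic family of representations of `G` by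
bounded invertible operators. (The inner product of Mathlib is conjugate linear in the first
variable.) -/
structure IsHolomorphicFamily {G : Type*} [Group G] {V : Type*}
    (ρ : ℂ → G → (L2 V →L[ℂ] L2 V)) : Prop where
  representation : ∀ z ∈ Metric.ball (0 : ℂ) 1,
    ∃ R : G →* (L2 V →L[ℂ] L2 V)ˣ, ∀ g, (R g : L2 V →L[ℂ] L2 V) = ρ z g
  holomorphic : ∀ (g : G) (ξ ξ' : L2 V),
    DifferentiableOn ℂ (fun z => inner ℂ ξ' (ρ z g ξ)) (Metric.ball (0 : ℂ) 1)

namespace CubeComplex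

variable {V : Type*} (X : CubeComplex V)

/-- The defining formula for the operator `c_z(x,y)` of adjacent vertices `x`, `y`. Let `H` be the
hyperplane of `{x,y}`, let `H₊` be the side of `x` and `H₋` the side of `y`. If `v` is adjacent to
`H` and `u` is opposite to `v` across `H`, then `T δ_v = w δ_v - z δ_u` for `v ∈ H₊`, and
`T δ_v = w δ_v + z δ_u` for `v ∈ H₋`; if `v` is not adjacent to `H`, then `T δ_v = δ_v`. -/
structure IsEdgeOp (z w : ℂ) (x y : V) (T : L2 V →L[ℂ] L2 V) : Prop where
  pos : ∀ v u, s(v, u) ∈ X.hyperplane x y → v ∈ X.side (X.hyperplane x y) x →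
    T (delta v) = w • delta v - z • delta u
  neg : ∀ v u, s(v, u) ∈ X.hyperplane x y → v ∈ X.side (X.hyperplane x y) y →
    T (delta v) = w • delta v + z • delta u
  other : ∀ v, (∀ u, s(v, u) ∉ X.hyperplane x y) → T (delta v) = delta v

open Classical in
/-- The operator `c_z(x,y)` for adjacent vertices `x`, `y` (the value is irrelevant if no operator
satisfies the defining formula). -/
def edgeOp (z w : ℂ) (x y : V) : L2 V →L[ℂ] L2 V :=
  if h : ∃ T, X.IsEdgeOp z w x y T then h.choose else 0

/-- The product `c_z(v₀,v₁) c_z(v₁,v₂) ⋯ c_z(vₙ₋₁,vₙ)` along an edge-path. -/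
def pathOp (z w : ℂ) : {x y : V} → X.graph.Walk x y → (L2 V →L[ℂ] L2 V)
  | _, _, SimpleGraph.Walk.nil => 1
  | _, _, @SimpleGraph.Walk.cons _ _ u v _ _ p => X.edgeOp z w u v * pathOp z w p

open Classical in
/-- `c_z(x,y)`: the product along some edge-path from `x` to `y` (the value is irrelevant if there
is none). -/
def cocycle (z w : ℂ) (x y : V) : L2 V →L[ℂ] L2 V :=
  if h : Nonempty (X.graph.Walk x y) then X.pathOp z w h.some else 0

/-- `π_z(g) = c_z(x,gx) π(g)`. -/
def cocycleRep {G : Type*} [Group G] [MulAction G V] (z w : ℂ) (x : V) (g : G) :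
    L2 V →L[ℂ] L2 V :=
  X.cocycle z w x (g • x) * permRep G g

end CubeComplex

end

/-! The analytic part is short once the combinatorics of hyperplanes is known: a hyperplane is the
set of all edges between two complementary half-spaces, a vertex lies on at most one of its edges,
and two hyperplanes that cross in some square cross in a square at every vertex adjacent to both.
These facts are derived from the metric definition of `CAT(0)`, with no bound on the dimension and
without a link condition.

Fix a vertex `x` and let the height be the distance to `x` in the realization. A path from a point
of a cube to `x` can be projected, in each coordinate direction, to one of the two sides of the
cube, with a Pythagorean gain in length (`PLPath.project`). So the height has no minimum inside a
segment parallel to an edge; by strict convexity it has no maximum there either. Hence opposite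
points of two parallel sides have different heights, and as the cube is connected, the height
orients all parallel edges of the cube in the same way (`height_lt_iff_of_isChart`).

The lower neighbors of a vertex `v` lie in one cube with `v` (`exists_chart_of_height_lt`). The
geodesic from `v` to `x` starts in some cube; a lower neighbor outside this cube would make with the
geodesic an angle of at least a right angle, as the coordinates along the edges at `v` show, but
comparison with the plane makes the angle acute. By induction, an edge descends for the height
exactly if it descends for the graph distance to `x` (`height_lt_iff`). So adjacent vertices have
different distances to `x`, two neighbors of `v` closer to `x` span a square with `v`, and opposite
edges of a square define the same half-spaces `{p | d(p,x) < d(p,y)}`. The hyperplane facts follow.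

The operator of an edge acts on the pair of ends of each edge of the hyperplane by a complex
rotation matrix, and reversing the edge inverts it. In a square, opposite edges have the same
operator and adjacent edges have commuting operators. Two geodesics with the same ends are related
by squares, and backtracking cancels, so the product does not depend on the path. Along a geodesic
from `x` each first edge contributes a factor `z` to the matrix coefficient, because the rest of the
geodesic never crosses its hyperplane again. -/

noncomputable section

/-! ### Charts of cubes -/

/-- The weight of the side `e` of the unit interval at the point `s`. -/
def sideWeight (e : Bool) (s : ℝ) : ℝ := if e then s else 1 - s

/-- The endpoint `e` of the unit interval. -/
def endpoint (e : Bool) : ℝ := if e then 1 else 0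

theorem sideWeight_not (e : Bool) (s : ℝ) : sideWeight (!e) s = 1 - sideWeight e s := by
  cases e <;> simp [sideWeight]

theorem sideWeight_endpoint (e e' : Bool) :
    sideWeight e (endpoint e') = if e = e' then 1 else 0 := by
  cases e <;> cases e' <;> simp [sideWeight, endpoint]

theorem sq_sub_endpoint (e : Bool) (s : ℝ) : (s - endpoint e) ^ 2 = (1 - sideWeight e s) ^ 2 := by
  cases e <;> simp [sideWeight, endpoint]; ring

theorem sq_sideWeight_sub (e : Bool) (s t : ℝ) :
    (sideWeight e s - sideWeight e t) ^ 2 = (s - t) ^ 2 := by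
  cases e <;> simp [sideWeight]; ring

theorem endpoint_mem (e : Bool) : 0 ≤ endpoint e ∧ endpoint e ≤ 1 := by
  cases e <;> simp [endpoint]

theorem sideWeight_mem (e : Bool) {s : ℝ} (h : 0 ≤ s ∧ s ≤ 1) :
    0 ≤ sideWeight e s ∧ sideWeight e s ≤ 1 := by
  cases e <;> simp [sideWeight, h.1, h.2]

/-- The neighbor of the vertex `f` of the standard cube in direction `i`. -/
def flipAt {n : ℕ} (f : Fin n → Bool) (i : Fin n) : Fin n → Bool := Function.update f i (!f i)

theorem flipAt_same {n : ℕ} (f : Fin n → Bool) (i : Fin n) : flipAt f i i = !f i := by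
  simp [flipAt]

theorem flipAt_of_ne {n : ℕ} (f : Fin n → Bool) {i j : Fin n} (h : j ≠ i) :
    flipAt f i j = f j := by
  simp [flipAt, h]

theorem flipAt_flipAt {n : ℕ} (f : Fin n → Bool) (i : Fin n) : flipAt (flipAt f i) i = f := by
  simp [flipAt]

theorem flipAt_ne {n : ℕ} (f : Fin n → Bool) (i : Fin n) : flipAt f i ≠ f := by
  intro h
  have := congrFun h i
  simp [flipAt] at this

theorem flipAt_injective {n : ℕ} (f : Fin n → Bool) : Function.Injective (flipAt f) := by
  intro i j h
  by_contra hij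
  have := congrFun h i
  simp [flipAt, hij] at this

/-- Replace the coordinate `i` of a point by `s`. -/
def setCoord {n : ℕ} (t : EuclideanSpace ℝ (Fin n)) (i : Fin n) (s : ℝ) :
    EuclideanSpace ℝ (Fin n) := WithLp.toLp 2 (Function.update t.ofLp i s)

theorem setCoord_same {n : ℕ} (t : EuclideanSpace ℝ (Fin n)) (i : Fin n) (s : ℝ) :
    setCoord t i s i = s := by
  simp [setCoord]

theorem setCoord_of_ne {n : ℕ} (t : EuclideanSpace ℝ (Fin n)) {i j : Fin n} (h : j ≠ i) (s : ℝ) :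
    setCoord t i s j = t j := by
  simp [setCoord, h]

theorem setCoord_self {n : ℕ} (t : EuclideanSpace ℝ (Fin n)) (i : Fin n) :
    setCoord t i (t i) = t := by
  simp [setCoord]

theorem setCoord_mem {n : ℕ} {t : EuclideanSpace ℝ (Fin n)} (ht : t ∈ unitCube n) (i : Fin n)
    {s : ℝ} (hs : 0 ≤ s ∧ s ≤ 1) : setCoord t i s ∈ unitCube n := by
  intro j
  by_cases h : j = i
  · subst h; rwa [setCoord_same]
  · rw [setCoord_of_ne t h]; exact ht j

/-- The vertex `f` as a point of the unit cube. -/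
def corner {n : ℕ} (f : Fin n → Bool) : EuclideanSpace ℝ (Fin n) :=
  WithLp.toLp 2 fun i => endpoint (f i)

theorem corner_apply {n : ℕ} (f : Fin n → Bool) (i : Fin n) : corner f i = endpoint (f i) := rfl

theorem corner_mem {n : ℕ} (f : Fin n → Bool) : corner f ∈ unitCube n := fun i =>
  endpoint_mem (f i)

theorem setCoord_corner {n : ℕ} (f : Fin n → Bool) (i : Fin n) :
    setCoord (corner f) i (endpoint (!f i)) = corner (flipAt f i) := by
  ext j
  by_cases h : j = i
  · subst h; rw [setCoord_same, corner_apply, flipAt_same]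
  · rw [setCoord_of_ne _ h, corner_apply, corner_apply, flipAt_of_ne _ h]

theorem dist_sq_eq_sum {n : ℕ} (s t : EuclideanSpace ℝ (Fin n)) :
    dist s t ^ 2 = ∑ i, (s i - t i) ^ 2 := by
  rw [EuclideanSpace.dist_eq, Real.sq_sqrt (Finset.sum_nonneg fun i _ => sq_nonneg _)]
  simp [Real.dist_eq, sq_abs]

theorem abs_coord_sub_le_dist {n : ℕ} (s t : EuclideanSpace ℝ (Fin n)) (i : Fin n) :
    |s i - t i| ≤ dist s t := by
  apply abs_le_of_sq_le_sq _ dist_nonneg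
  rw [dist_sq_eq_sum]
  exact Finset.single_le_sum (f := fun i => (s i - t i) ^ 2) (fun i _ => sq_nonneg _)
    (Finset.mem_univ i)

theorem dist_setCoord_sq {n : ℕ} (s t : EuclideanSpace ℝ (Fin n)) (i : Fin n) (r : ℝ) :
    dist (setCoord s i r) (setCoord t i r) ^ 2 + (s i - t i) ^ 2 = dist s t ^ 2 := by
  rw [dist_sq_eq_sum, dist_sq_eq_sum, ← Finset.add_sum_erase _ _ (Finset.mem_univ i),
    ← Finset.add_sum_erase (s := Finset.univ) (f := fun j => (s j - t j) ^ 2) (Finset.mem_univ i),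
    setCoord_same, setCoord_same, Finset.sum_congr rfl
      (g := fun j => (s j - t j) ^ 2) (fun j hj => by
        rw [setCoord_of_ne _ (Finset.ne_of_mem_erase hj),
          setCoord_of_ne _ (Finset.ne_of_mem_erase hj)])]
  ring

theorem dist_setCoord {n : ℕ} (t : EuclideanSpace ℝ (Fin n)) (i : Fin n) (r r' : ℝ) :
    dist (setCoord t i r) (setCoord t i r') = |r - r'| := by
  rw [← abs_of_nonneg (dist_nonneg (x := setCoord t i r)), ← sq_eq_sq_iff_abs_eq_abs,
    dist_sq_eq_sum, Finset.sum_eq_single i]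
  · rw [setCoord_same, setCoord_same]
  · intro j _ hj
    rw [setCoord_of_ne _ hj, setCoord_of_ne _ hj]; ring
  · simp

/-! ### Weights of a point of a cube at the vertices -/

section cubePoint

variable {V : Type*} {n : ℕ} {φ : (Fin n → Bool) → V}

theorem cubePoint_apply (hφ : Function.Injective φ) (t : EuclideanSpace ℝ (Fin n))
    (f : Fin n → Bool) : cubePoint φ t (φ f) = ∏ i, sideWeight (f i) (t i) := by
  classical
  simp [cubePoint, Finsupp.finsetSum_apply, Finsupp.single_apply, hφ.eq_iff, sideWeight]

theorem cubePoint_apply_of_notMem {u : V} (hu : u ∉ Set.range φ) (t : EuclideanSpace ℝ (Fin n)) :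
    cubePoint φ t u = 0 := by
  classical
  simp only [cubePoint, Finsupp.finsetSum_apply, Finsupp.single_apply]
  exact Finset.sum_eq_zero fun f _ => if_neg fun h => hu ⟨f, h⟩

theorem exists_of_cubePoint_ne_zero {u : V} {t : EuclideanSpace ℝ (Fin n)}
    (hu : cubePoint φ t u ≠ 0) : ∃ f, φ f = u := by
  by_contra h
  exact hu (cubePoint_apply_of_notMem h t)

theorem cubePoint_corner (hφ : Function.Injective φ) (f : Fin n → Bool) :
    cubePoint φ (corner f) = Finsupp.single (φ f) 1 := by
  classical
  ext u
  by_cases hu : u ∈ Set.range φ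
  · obtain ⟨h, rfl⟩ := hu
    rw [cubePoint_apply hφ, Finsupp.single_apply]
    simp only [corner_apply, sideWeight_endpoint]
    by_cases hh : h = f
    · subst hh; simp
    · rw [if_neg fun e => hh (hφ e.symm)]
      obtain ⟨i, hi⟩ := Function.ne_iff.1 hh
      exact Finset.prod_eq_zero (Finset.mem_univ i) (if_neg hi)
  · rw [cubePoint_apply_of_notMem hu, Finsupp.single_apply, if_neg]
    rintro rfl
    exact hu ⟨f, rfl⟩

theorem cubePoint_apply_eq_mul (hφ : Function.Injective φ) (t : EuclideanSpace ℝ (Fin n))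
    (f : Fin n → Bool) (i : Fin n) : cubePoint φ t (φ f) =
      sideWeight (f i) (t i) * ∏ j ∈ Finset.univ.erase i, sideWeight (f j) (t j) := by
  rw [cubePoint_apply hφ, Finset.mul_prod_erase _ (fun j => sideWeight (f j) (t j))
    (Finset.mem_univ i)]

theorem cubePoint_flipAt (hφ : Function.Injective φ) (t : EuclideanSpace ℝ (Fin n))
    (f : Fin n → Bool) (i : Fin n) : cubePoint φ t (φ (flipAt f i)) =
      (1 - sideWeight (f i) (t i)) * ∏ j ∈ Finset.univ.erase i, sideWeight (f j) (t j) := by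
  rw [cubePoint_apply_eq_mul hφ t _ i, flipAt_same, sideWeight_not]
  congr 1
  exact Finset.prod_congr rfl fun j hj => by rw [flipAt_of_ne _ (Finset.ne_of_mem_erase hj)]

/-- The weights are a product measure on the vertices, and projecting to a side means conditioning
on one coordinate. Multiplying by the mass of the side avoids a division. -/
theorem sideWeight_mul_cubePoint_setCoord (hφ : Function.Injective φ)
    (t : EuclideanSpace ℝ (Fin n)) (f : Fin n → Bool) (i : Fin n) (e : Bool) :
    sideWeight e (t i) * cubePoint φ (setCoord t i (endpoint e)) (φ f) =
      if f i = e then cubePoint φ t (φ f) else 0 := by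
  rw [cubePoint_apply_eq_mul hφ _ f i, cubePoint_apply_eq_mul hφ t f i, setCoord_same,
    sideWeight_endpoint, Finset.prod_congr rfl
      (g := fun j => sideWeight (f j) (t j)) (fun j hj => by
        rw [setCoord_of_ne _ (Finset.ne_of_mem_erase hj)])]
  split_ifs with h
  · rw [h]; ring
  · ring

/-- Rounding gives a nearest vertex of the cube. Its weight is positive, and stays so when one
coordinate moves, short of the opposite side. -/
theorem exists_half_le_sideWeight (t : EuclideanSpace ℝ (Fin n)) :
    ∃ f : Fin n → Bool, ∀ j, 1 / 2 ≤ sideWeight (f j) (t j) := by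
  refine ⟨fun j => decide (1 / 2 ≤ t j), fun j => ?_⟩
  by_cases h : 1 / 2 ≤ t j
  · simpa only [decide_eq_true h, sideWeight, if_true] using h
  · simp only [decide_eq_false h, sideWeight]
    norm_num
    linarith

end cubePoint

/-! ### Faces, edges and squares of a chart; change of charts -/

namespace CubeComplex

variable {V : Type*} {X : CubeComplex V}

/-- `φ` parametrizes a cube of `X`. -/
structure IsChart (X : CubeComplex V) {n : ℕ} (φ : (Fin n → Bool) → V) : Prop where
  mem : Set.range φ ∈ X.cubes
  param : IsCubeParam X.cubes (Set.range φ) φ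

theorem exists_isChart {C : Set V} (hC : C ∈ X.cubes) :
    ∃ (n : ℕ) (φ : (Fin n → Bool) → V), X.IsChart φ ∧ Set.range φ = C := by
  obtain ⟨n, φ, h⟩ := X.exists_param C hC
  have e := h.range_eq
  subst e
  exact ⟨n, φ, ⟨hC, h⟩, rfl⟩

theorem isChart_of_isCubeParam {C : Set V} (hC : C ∈ X.cubes) {n : ℕ} {φ : (Fin n → Bool) → V}
    (h : IsCubeParam X.cubes C φ) : X.IsChart φ := by
  have e := h.range_eq
  subst e
  exact ⟨hC, h⟩

namespace IsChart

variable {n : ℕ} {φ : (Fin n → Bool) → V}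

theorem injective (h : X.IsChart φ) : Function.Injective φ := h.param.injective

theorem image_face_mem (h : X.IsChart φ) {F : Set (Fin n → Bool)} (hF : IsCubeFace F) :
    φ '' F ∈ X.cubes :=
  (h.param.mem_iff _ (Set.image_subset_range _ _)).2 ⟨F, hF, rfl⟩

theorem exists_face (h : X.IsChart φ) {D : Set V} (hD : D ∈ X.cubes) (hs : D ⊆ Set.range φ) :
    ∃ (I : Set (Fin n)) (a : Fin n → Bool), ∀ f, φ f ∈ D ↔ ∀ i ∈ I, f i = a i := by
  obtain ⟨F, ⟨I, a, rfl⟩, rfl⟩ := (h.param.mem_iff D hs).1 hD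
  exact ⟨I, a, fun f => h.injective.mem_set_image⟩

theorem adj_flipAt (h : X.IsChart φ) (f : Fin n → Bool) (i : Fin n) :
    X.graph.Adj (φ f) (φ (flipAt f i)) := by
  refine ⟨fun e => flipAt_ne f i (h.injective e).symm, ?_⟩
  have hF : IsCubeFace {g : Fin n → Bool | ∀ j ∈ ({i}ᶜ : Set (Fin n)), g j = f j} := ⟨_, _, rfl⟩
  convert h.image_face_mem hF using 1
  ext u
  simp only [Set.mem_insert_iff, Set.mem_singleton_iff, Set.mem_image, Set.mem_ofPred_eq,
    Set.mem_compl_iff]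
  constructor
  · rintro (rfl | rfl)
    · exact ⟨f, fun _ _ => rfl, rfl⟩
    · exact ⟨_, fun j hj => flipAt_of_ne f hj, rfl⟩
  · rintro ⟨g, hg, rfl⟩
    by_cases e : g i = f i
    · left
      congr 1; ext j
      by_cases hj : j = i
      · rw [hj, e]
      · rw [hg j hj]
    · right
      congr 1; ext j
      by_cases hj : j = i
      · rw [hj, flipAt_same, Bool.eq_not_of_ne e]
      · rw [hg j hj, flipAt_of_ne f hj]

/-- An edge inside the cube is a face. A coordinate in which its ends differ is free on this face,
so the flip in this coordinate is the other end. -/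
theorem exists_flipAt_of_adj (h : X.IsChart φ) {f : Fin n → Bool} {u : V}
    (hu : X.graph.Adj (φ f) u) (hr : u ∈ Set.range φ) : ∃ i, u = φ (flipAt f i) := by
  obtain ⟨g, rfl⟩ := hr
  obtain ⟨I, a, hI⟩ := h.exists_face hu.2 (by
    rintro _ (rfl | rfl) <;> exact Set.mem_range_self _)
  have hf := (hI f).1 (Or.inl rfl)
  have hg := (hI g).1 (Or.inr rfl)
  have hne : f ≠ g := fun e => hu.1 (by rw [e])
  obtain ⟨i, hi⟩ := Function.ne_iff.1 hne
  refine ⟨i, ?_⟩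
  have hiI : i ∉ I := fun hh => hi ((hf i hh).trans (hg i hh).symm)
  have : φ (flipAt f i) ∈ ({φ f, φ g} : Set V) := (hI _).2 fun j hj => by
    rw [flipAt_of_ne f (ne_of_mem_of_not_mem hj hiI), hf j hj]
  rcases this with h' | h'
  · exact absurd (h.injective h') (flipAt_ne f i)
  · exact h'.symm

theorem square_mem (h : X.IsChart φ) (f : Fin n → Bool) {i j : Fin n} (hij : i ≠ j) :
    {φ f, φ (flipAt f j), φ (flipAt f i), φ (flipAt (flipAt f i) j)} ∈ X.cubes ∧
    ({φ f, φ (flipAt f j), φ (flipAt f i), φ (flipAt (flipAt f i) j)} : Set V).ncard = 4 := by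
  have e1 : flipAt f j ≠ flipAt f i := fun e => hij (flipAt_injective f e).symm
  have e2 : f ≠ flipAt (flipAt f i) j := fun e => by
    have := congrFun e i
    rw [flipAt_of_ne _ hij, flipAt_same] at this
    simp at this
  have e3 : flipAt f j ≠ flipAt (flipAt f i) j := fun e => by
    have := congrFun e i
    rw [flipAt_of_ne _ hij, flipAt_of_ne _ hij, flipAt_same] at this
    simp at this
  have e4 := flipAt_ne f i
  have e5 := flipAt_ne f j
  have e6 := flipAt_ne (flipAt f i) j
  constructor
  · have hF : IsCubeFace {g : Fin n → Bool | ∀ k ∈ ({i, j}ᶜ : Set (Fin n)), g k = f k} :=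
      ⟨_, _, rfl⟩
    convert h.image_face_mem hF using 1
    ext u
    simp only [Set.mem_insert_iff, Set.mem_singleton_iff, Set.mem_image, Set.mem_ofPred_eq,
      Set.mem_compl_iff, not_or]
    constructor
    · rintro (rfl | rfl | rfl | rfl)
      · exact ⟨f, fun _ _ => rfl, rfl⟩
      · exact ⟨_, fun k hk => flipAt_of_ne f hk.2, rfl⟩
      · exact ⟨_, fun k hk => flipAt_of_ne f hk.1, rfl⟩
      · exact ⟨_, fun k hk => by rw [flipAt_of_ne _ hk.2, flipAt_of_ne f hk.1], rfl⟩
    · rintro ⟨g, hg, rfl⟩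
      have key : ∀ g' : Fin n → Bool, g i = g' i → g j = g' j →
          (∀ k, k ≠ i ∧ k ≠ j → g' k = f k) → φ g = φ g' := by
        intro g' h1 h2 h3
        congr 1; ext k
        by_cases hk : k = i
        · rw [hk, h1]
        · by_cases hk' : k = j
          · rw [hk', h2]
          · rw [hg k ⟨hk, hk'⟩, h3 k ⟨hk, hk'⟩]
      by_cases hi : g i = f i <;> by_cases hj : g j = f j
      · exact Or.inl (key f hi hj fun _ _ => rfl)
      · exact Or.inr (Or.inl (key _ (by rw [flipAt_of_ne f hij, hi])
          (by rw [flipAt_same, Bool.eq_not_of_ne hj]) fun k hk => flipAt_of_ne f hk.2))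
      · exact Or.inr (Or.inr (Or.inl (key _ (by rw [flipAt_same, Bool.eq_not_of_ne hi])
          (by rw [flipAt_of_ne f hij.symm, hj]) fun k hk => flipAt_of_ne f hk.1)))
      · exact Or.inr (Or.inr (Or.inr (key _
          (by rw [flipAt_of_ne _ hij, flipAt_same, Bool.eq_not_of_ne hi])
          (by rw [flipAt_same, flipAt_of_ne _ hij.symm, Bool.eq_not_of_ne hj])
          fun k hk => by rw [flipAt_of_ne _ hk.2, flipAt_of_ne f hk.1])))
  · have inj := h.injective
    rw [Set.ncard_insert_of_notMem, Set.ncard_insert_of_notMem, Set.ncard_pair]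
    · exact fun e => e6 (inj e).symm
    · simp only [Set.mem_insert_iff, Set.mem_singleton_iff, inj.eq_iff]
      tauto
    · simp only [Set.mem_insert_iff, Set.mem_singleton_iff, inj.eq_iff]
      tauto

theorem reachable (h : X.IsChart φ) (f g : Fin n → Bool) :
    X.graph.Reachable (φ f) (φ g) := by
  classical
  have key : ∀ S : Finset (Fin n), X.graph.Reachable (φ f) (φ (S.piecewise g f)) := by
    intro S
    induction S using Finset.induction_on with
    | empty => simp
    | insert i S hi ih =>
      refine ih.trans ?_
      by_cases e : g i = f i
      · rw [Finset.piecewise_insert, e]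
        rw [Function.update_eq_self_iff.2 (by simp [hi])]
      · have : (insert i S).piecewise g f = flipAt (S.piecewise g f) i := by
          rw [Finset.piecewise_insert, flipAt]
          congr 1
          simp only [hi, not_false_eq_true, Finset.piecewise_eq_of_notMem]
          exact Bool.eq_not_of_ne e
        rw [this]
        exact (h.adj_flipAt _ i).reachable
  simpa using key Finset.univ

/-- The point of the realization with coordinates `t` in the chart `φ`. -/
def point (h : X.IsChart φ) (t : EuclideanSpace ℝ (Fin n)) (ht : t ∈ unitCube n) :
    X.Realization :=
  ⟨cubePoint φ t, _, h.mem, n, φ, h.param, t, ht, rfl⟩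

theorem step (h : X.IsChart φ) {s t : EuclideanSpace ℝ (Fin n)} (hs : s ∈ unitCube n)
    (ht : t ∈ unitCube n) {p q : X.Realization} (hp : p.1 = cubePoint φ s)
    (hq : q.1 = cubePoint φ t) : X.Step p q (dist s t) :=
  ⟨_, h.mem, n, φ, h.param, s, hs, t, ht, hp, hq, rfl⟩

/-- Parallel classes are the same in both charts: the side of `φ` given by the coordinate `i` meets
the cube of `ψ` in a face that contains `ψ g` but not its `i'`-neighbor, so `i'` is prescribed on
this face. -/
theorem apply_eq_of_apply_eq (h : X.IsChart φ) {k : ℕ} {ψ : (Fin k → Bool) → V}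
    (h' : X.IsChart ψ) {f f' : Fin n → Bool} {g g' : Fin k → Bool} {i : Fin n} {i' : Fin k}
    (e1 : φ f = ψ g) (e2 : φ (flipAt f i) = ψ (flipAt g i')) (e3 : φ f' = ψ g')
    (hf : f' i = f i) : g' i' = g i' := by
  have hF : IsCubeFace {c : Fin n → Bool | ∀ j ∈ ({i} : Set (Fin n)), c j = f j} := ⟨_, _, rfl⟩
  have hP : φ '' {c : Fin n → Bool | ∀ j ∈ ({i} : Set (Fin n)), c j = f j} ∩ Set.range ψ ∈
      X.cubes := X.inter_mem _ (h.image_face_mem hF) _ h'.mem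
        ⟨φ f, ⟨f, fun _ _ => rfl, rfl⟩, e1 ▸ Set.mem_range_self _⟩
  obtain ⟨I, a, hI⟩ := h'.exists_face hP Set.inter_subset_right
  have hg := (hI g).1 ⟨⟨f, fun _ _ => rfl, e1⟩, Set.mem_range_self _⟩
  have hg' := (hI g').1 ⟨⟨f', fun j hj => by rw [Set.mem_singleton_iff.1 hj, hf], e3⟩,
    Set.mem_range_self _⟩
  by_cases hi : i' ∈ I
  · rw [hg _ hi, hg' _ hi]
  · exfalso
    have := (hI (flipAt g i')).2 fun j hj => by
      rw [flipAt_of_ne g (ne_of_mem_of_not_mem hj hi), hg j hj]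
    rw [← e2] at this
    have h3 := (h.injective.mem_set_image.1 this.1) i rfl
    rw [flipAt_same] at h3
    simp at h3

/-- A coordinate of a point in one chart, if it is neither `0` nor `1`, corresponds to a coordinate
in any other chart, with the same projections to the two sides. -/
theorem transfer (h : X.IsChart φ) {k : ℕ} {ψ : (Fin k → Bool) → V} (h' : X.IsChart ψ)
    {t : EuclideanSpace ℝ (Fin n)} {t' : EuclideanSpace ℝ (Fin k)}
    (e : cubePoint φ t = cubePoint ψ t') {i : Fin n} (h0 : 0 < t i) (h1 : t i < 1) :
    ∃ i', ∀ b', ∃ b, cubePoint φ (setCoord t i (endpoint b)) =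
      cubePoint ψ (setCoord t' i' (endpoint b')) ∧
      sideWeight b (t i) = sideWeight b' (t' i') := by
  -- As `t i` is strictly between `0` and `1`, both ends of the edge in direction `i` at the nearest
  -- vertex have positive weight. So this edge is also an edge of the other cube, and its direction
  -- there is `i'`.
  obtain ⟨f, hf⟩ := exists_half_le_sideWeight t
  have hpos : ∀ b, 0 < sideWeight b (t i) := by
    intro b; cases b <;> simp [sideWeight, h0, h1]
  have hM : 0 < ∏ j ∈ Finset.univ.erase i, sideWeight (f j) (t j) :=
    Finset.prod_pos fun j _ => by linarith [hf j]
  have m1 := cubePoint_apply_eq_mul h.injective t f i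
  have m2 := cubePoint_flipAt h.injective t f i
  have p1 : 0 < cubePoint φ t (φ f) := by rw [m1]; exact mul_pos (hpos _) hM
  have p2 : 0 < cubePoint φ t (φ (flipAt f i)) := by
    rw [m2, ← sideWeight_not]; exact mul_pos (hpos _) hM
  obtain ⟨g, hg⟩ := exists_of_cubePoint_ne_zero (e ▸ p1.ne')
  obtain ⟨g1, hg1⟩ := exists_of_cubePoint_ne_zero (e ▸ p2.ne')
  obtain ⟨i', hi'⟩ := h'.exists_flipAt_of_adj (hg ▸ h.adj_flipAt f i) ⟨g1, hg1⟩
  have m3 := cubePoint_apply_eq_mul h'.injective t' g i'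
  have m4 := cubePoint_flipAt h'.injective t' g i'
  rw [← e, hg] at m3
  rw [← e, ← hi'] at m4
  have key : sideWeight (f i) (t i) = sideWeight (g i') (t' i') := by
    set M := ∏ j ∈ Finset.univ.erase i, sideWeight (f j) (t j)
    set M' := ∏ j ∈ Finset.univ.erase i', sideWeight (g j) (t' j)
    have hMM : M = M' := by linarith
    rw [m1, hMM] at m3
    exact mul_right_cancel₀ (hMM ▸ hM.ne') m3
  have par : ∀ c c', φ c = ψ c' → (c i = f i ↔ c' i' = g i') := by
    intro c c' hc
    constructor
    · exact h.apply_eq_of_apply_eq h' hg.symm hi' hc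
    · exact h'.apply_eq_of_apply_eq h hg hi'.symm hc.symm
  -- The charts may orient the direction oppositely; `xor (f i) (g i')` records whether they do.
  refine ⟨i', fun b' => ⟨xor (xor (f i) (g i')) b', ?_⟩⟩
  have hb : sideWeight (xor (xor (f i) (g i')) b') (t i) = sideWeight b' (t' i') := by
    revert key
    cases f i <;> cases g i' <;> cases b' <;> simp [sideWeight] <;> intro hh <;> linarith
  refine ⟨?_, hb⟩
  have par' : ∀ c c', φ c = ψ c' → (c i = xor (xor (f i) (g i')) b' ↔ c' i' = b') := by
    intro c c' hc
    have := par c c' hc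
    revert this
    cases f i <;> cases g i' <;> cases b' <;> cases c i <;> cases c' i' <;> simp
  set b := xor (xor (f i) (g i')) b'
  ext u
  refine mul_left_cancel₀ (hpos b).ne' ?_
  by_cases hu : u ∈ Set.range φ
  · obtain ⟨c, rfl⟩ := hu
    rw [sideWeight_mul_cubePoint_setCoord h.injective]
    by_cases hu' : φ c ∈ Set.range ψ
    · obtain ⟨c', hc'⟩ := hu'
      rw [← hc', hb, sideWeight_mul_cubePoint_setCoord h'.injective, hc', ← e]
      simp only [par' c c' hc'.symm]
    · rw [cubePoint_apply_of_notMem hu', e, cubePoint_apply_of_notMem hu']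
      simp
  · rw [cubePoint_apply_of_notMem hu]
    by_cases hu' : u ∈ Set.range ψ
    · obtain ⟨c', rfl⟩ := hu'
      rw [hb, sideWeight_mul_cubePoint_setCoord h'.injective, ← e, cubePoint_apply_of_notMem hu]
      simp
    · rw [cubePoint_apply_of_notMem hu']

end IsChart

/-! ### Piecewise linear paths and their projections to the sides of a cube -/

theorem Step.exists_chart {p q : X.Realization} {ℓ : ℝ} (h : X.Step p q ℓ) :
    ∃ (n : ℕ) (φ : (Fin n → Bool) → V), X.IsChart φ ∧ ∃ s ∈ unitCube n, ∃ t ∈ unitCube n,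
      p.1 = cubePoint φ s ∧ q.1 = cubePoint φ t ∧ ℓ = dist s t := by
  obtain ⟨C, hC, n, φ, hφ, h⟩ := h
  exact ⟨n, φ, isChart_of_isCubeParam hC hφ, h⟩

theorem Realization.exists_chart (p : X.Realization) :
    ∃ (n : ℕ) (φ : (Fin n → Bool) → V), X.IsChart φ ∧ ∃ t ∈ unitCube n, p.1 = cubePoint φ t := by
  obtain ⟨C, hC, n, φ, hφ, h⟩ := p.2
  exact ⟨n, φ, isChart_of_isCubeParam hC hφ, h⟩

variable (X) in
/-- A vertex as a point of the realization. -/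
def vertex (v : V) : X.Realization :=
  ⟨Finsupp.single v 1, by
    obtain ⟨n, φ, h, hr⟩ := exists_isChart (X.singleton_mem v)
    obtain ⟨f, hf⟩ : v ∈ Set.range φ := hr ▸ rfl
    exact ⟨_, h.mem, n, φ, h.param, corner f, corner_mem f, by
      rw [cubePoint_corner h.injective, hf]⟩⟩

theorem IsChart.vertex_eq {n : ℕ} {φ : (Fin n → Bool) → V} (h : X.IsChart φ)
    (f : Fin n → Bool) : (X.vertex (φ f)).1 = cubePoint φ (corner f) :=
  (cubePoint_corner h.injective f).symm

theorem PLPath.nonneg {p q : X.Realization} {ℓ : ℝ} (h : X.PLPath p q ℓ) : 0 ≤ ℓ := by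
  induction h with
  | nil p => rfl
  | cons h1 _ ih =>
    obtain ⟨C, hC, n, φ, hφ, s, hs, t, ht, -, -, rfl⟩ := h1
    exact add_nonneg dist_nonneg ih

theorem Step.plPath {p q : X.Realization} {ℓ : ℝ} (h : X.Step p q ℓ) : X.PLPath p q ℓ := by
  simpa using PLPath.cons h (PLPath.nil q)

/-- A path to a vertex that starts at a point of a cube has to leave each of the directions of the
cube on one of its two sides; projecting it to this side makes it shorter. -/
theorem PLPath.project {p q : X.Realization} {ℓ : ℝ} (hp : X.PLPath p q ℓ) {v : V}
    (hq : q = X.vertex v) {n : ℕ} {φ : (Fin n → Bool) → V} (h : X.IsChart φ)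
    {t : EuclideanSpace ℝ (Fin n)} (ht : t ∈ unitCube n) (hpt : p.1 = cubePoint φ t) (i : Fin n) :
    ∃ (e : Bool) (p' : X.Realization) (ℓ' : ℝ), p'.1 = cubePoint φ (setCoord t i (endpoint e)) ∧
      X.PLPath p' q ℓ' ∧ ℓ' ^ 2 + (t i - endpoint e) ^ 2 ≤ ℓ ^ 2 := by
  induction hp generalizing n with
  | nil p =>
    subst hq
    -- A vertex has only one nonzero weight; a coordinate strictly between `0` and `1` would give
    -- two.
    have : t i = endpoint true ∨ t i = endpoint false := by
      by_contra hh
      push Not at hh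
      simp only [endpoint, if_true] at hh
      have h1 : t i < 1 := lt_of_le_of_ne (ht i).2 hh.1
      have h0 : 0 < t i := lt_of_le_of_ne (ht i).1 (Ne.symm (by simpa using hh.2))
      obtain ⟨f, hf⟩ := exists_half_le_sideWeight t
      have hM : 0 < ∏ j ∈ Finset.univ.erase i, sideWeight (f j) (t j) :=
        Finset.prod_pos fun j _ => by linarith [hf j]
      have hpos : ∀ b, 0 < sideWeight b (t i) := by
        intro b; cases b <;> simp [sideWeight, h0, h1]
      have supp : ∀ u, (X.vertex v).1 u ≠ 0 → u = v := by
        intro u hu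
        by_contra hne
        exact hu (by simp [vertex, Ne.symm hne])
      have p1 := supp (φ f) (by
        rw [hpt, cubePoint_apply_eq_mul h.injective t f i]; exact (mul_pos (hpos _) hM).ne')
      have p2 := supp (φ (flipAt f i)) (by
        rw [hpt, cubePoint_flipAt h.injective t f i, ← sideWeight_not]
        exact (mul_pos (hpos _) hM).ne')
      exact flipAt_ne f i (h.injective (p2.trans p1.symm))
    obtain ⟨e, he⟩ : ∃ e, t i = endpoint e := by
      rcases this with h | h <;> exact ⟨_, h⟩
    exact ⟨e, _, 0, by rw [← he, setCoord_self, hpt], PLPath.nil _, by rw [he]; simp⟩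
  | @cons p r q a b hs hpath ih =>
    by_cases hti : ∃ e, t i = endpoint e
    · obtain ⟨e, he⟩ := hti
      exact ⟨e, _, _, by rw [← he, setCoord_self, hpt], hpath.cons hs, by rw [he]; simp⟩
    have h1 : t i < 1 := lt_of_le_of_ne (ht i).2 fun e => hti ⟨true, e⟩
    have h0 : 0 < t i := lt_of_le_of_ne (ht i).1 fun e => hti ⟨false, by simp [endpoint, ← e]⟩
    obtain ⟨k, ψ, h', x, hx, y, hy, hpx, hry, rfl⟩ := hs.exists_chart
    -- The direction is followed into the cube of the first step. The rest of the path decides on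
    -- the side, which is then translated back to the chart `φ`.
    obtain ⟨i', hi'⟩ := h.transfer h' (hpt.symm.trans hpx) h0 h1
    obtain ⟨e', r', ℓ', hr', hpath', hle⟩ := ih hq h' hy hry i'
    obtain ⟨e, he, hw⟩ := hi' e'
    refine ⟨e, h.point _ (setCoord_mem ht i (endpoint_mem e)),
      dist (setCoord x i' (endpoint e')) (setCoord y i' (endpoint e')) + ℓ', rfl,
      PLPath.cons (h'.step (setCoord_mem hx i' (endpoint_mem e'))
        (setCoord_mem hy i' (endpoint_mem e')) he hr') hpath', ?_⟩
    have hd := dist_setCoord_sq x y i' (endpoint e')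
    have hb := hpath.nonneg
    have hl := hpath'.nonneg
    rw [sq_sub_endpoint, hw, ← sq_sub_endpoint]
    set δ := dist (setCoord x i' (endpoint e')) (setCoord y i' (endpoint e'))
    have hδ : 0 ≤ δ := dist_nonneg
    set D := dist x y
    have hD : 0 ≤ D := dist_nonneg
    set α := x i' - y i'
    set β := y i' - endpoint e'
    have e1 : x i' - endpoint e' = α + β := by ring
    rw [e1]
    -- Cauchy-Schwarz for `(δ, α)` and `(ℓ', β)`, whose norms are equal to `D` and at most `b`. It
    -- yields the triangle inequality in the plane for their sum, which is the claim.
    have cs : δ * ℓ' + α * β ≤ D * b := by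
      apply le_of_abs_le
      apply abs_le_of_sq_le_sq _ (by positivity)
      calc (δ * ℓ' + α * β) ^ 2 ≤ (δ ^ 2 + α ^ 2) * (ℓ' ^ 2 + β ^ 2) := by
            nlinarith [sq_nonneg (δ * β - α * ℓ')]
        _ ≤ D ^ 2 * b ^ 2 := by
            rw [hd]; exact mul_le_mul_of_nonneg_left hle (sq_nonneg _)
        _ = (D * b) ^ 2 := by ring
    nlinarith

end CubeComplex

/-! ### The distance of a `CAT(0)` space as a real number -/

section RealDistance

variable {E : Type*} [PseudoEMetricSpace E]

/-- The distance as a real number. -/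
def realDist (p q : E) : ℝ := (edist p q).toReal

theorem realDist_nonneg (p q : E) : 0 ≤ realDist p q := ENNReal.toReal_nonneg

theorem realDist_self (p : E) : realDist p p = 0 := by simp [realDist]

theorem realDist_comm (p q : E) : realDist p q = realDist q p := by
  rw [realDist, realDist, edist_comm]

namespace IsCAT0Space

variable (hE : IsCAT0Space E)
include hE

theorem edist_eq (p q : E) : edist p q = ENNReal.ofReal (realDist p q) :=
  (ENNReal.ofReal_toReal (hE.edist_ne_top p q)).symm

theorem realDist_triangle (p q r : E) : realDist p r ≤ realDist p q + realDist q r := by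
  rw [realDist, realDist, realDist,
    ← ENNReal.toReal_add (hE.edist_ne_top p q) (hE.edist_ne_top q r)]
  exact ENNReal.toReal_mono (ENNReal.add_ne_top.2 ⟨hE.edist_ne_top p q, hE.edist_ne_top q r⟩)
    (edist_triangle p q r)

theorem edist_add_edist {p x q : E} (h : realDist p x + realDist x q = realDist p q) :
    edist p x + edist x q = edist p q := by
  rw [hE.edist_eq, hE.edist_eq, hE.edist_eq,
    ← ENNReal.ofReal_add (realDist_nonneg _ _) (realDist_nonneg _ _), h]

/-- The comparison of the third side in a triangle with vertex `p` by the law of cosines. -/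
theorem realDist_sq_le {p q r x y : E} (hq : 0 < realDist p q) (hr : 0 < realDist p r)
    (hx : realDist p x + realDist x q = realDist p q)
    (hy : realDist p y + realDist y r = realDist p r) :
    realDist x y ^ 2 ≤ realDist p x ^ 2 + realDist p y ^ 2 - realDist p x * realDist p y *
      ((realDist p q ^ 2 + realDist p r ^ 2 - realDist q r ^ 2) /
        (realDist p q * realDist p r)) := by
  set A := realDist p q with hA
  set B := realDist p r with hB
  set C := realDist q r with hC
  set ε := realDist p x with hε
  set s := realDist p y with hs
  have t1 : C ≤ A + B := by
    have := hE.realDist_triangle q p r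
    rwa [realDist_comm q p] at this
  have t2 : A ≤ B + C := by
    have := hE.realDist_triangle p r q
    rwa [realDist_comm r q] at this
  have t3 : B ≤ A + C := hE.realDist_triangle p q r
  have hC0 : 0 ≤ C := realDist_nonneg _ _
  have hε0 : 0 ≤ ε := realDist_nonneg _ _
  have hs0 : 0 ≤ s := realDist_nonneg _ _
  have hxq : realDist x q = A - ε := by linarith
  have hyr : realDist y r = B - s := by linarith
  have hxq0 : 0 ≤ A - ε := hxq ▸ realDist_nonneg _ _
  have hyr0 : 0 ≤ B - s := hyr ▸ realDist_nonneg _ _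
  -- The cosine of the comparison angle at `p`; with the sine `d`, the comparison triangle is
  -- `(0,0)`, `(A,0)`, `(B c, B d)`.
  set c := (A ^ 2 + B ^ 2 - C ^ 2) / (2 * (A * B)) with hc
  have hAB : 0 < A * B := mul_pos hq hr
  have hcAB : c * (2 * (A * B)) = A ^ 2 + B ^ 2 - C ^ 2 := by
    rw [hc]; field_simp
  have c1 : c ≤ 1 := by
    rw [hc, div_le_one (by positivity)]
    nlinarith
  have c2 : -1 ≤ c := by
    rw [hc, le_div_iff₀ (by positivity)]
    nlinarith
  set d := Real.sqrt (1 - c ^ 2) with hd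
  have hcd : c ^ 2 + d ^ 2 = 1 := by
    rw [hd, Real.sq_sqrt (by nlinarith)]; ring
  have plane : ∀ (a b a' b' ℓ : ℝ), 0 ≤ ℓ → (a - a') ^ 2 + (b - b') ^ 2 = ℓ ^ 2 →
      edist (!₂[a, b] : EuclideanSpace ℝ (Fin 2)) !₂[a', b'] = ENNReal.ofReal ℓ := by
    intro a b a' b' ℓ hℓ h
    rw [edist_dist, EuclideanSpace.dist_eq]
    simp only [Fin.sum_univ_two, Real.dist_eq, sq_abs]
    simp only [Matrix.cons_val_zero, Matrix.cons_val_one]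
    rw [h, Real.sqrt_sq hℓ]
  set m := ε ^ 2 + s ^ 2 - ε * s * (2 * c) with hm
  have hm0 : 0 ≤ m := by nlinarith [sq_nonneg (ε - s * c), sq_nonneg (s * d)]
  have := hE.comparison p q r x y (hE.edist_add_edist hx) (hE.edist_add_edist hy)
    !₂[0, 0] !₂[A, 0] !₂[B * c, B * d] !₂[ε, 0] !₂[s * c, s * d]
    (by rw [hE.edist_eq]; exact plane _ _ _ _ _ hq.le (by ring))
    (by rw [hE.edist_eq]; exact plane _ _ _ _ _ hr.le (by linear_combination B ^ 2 * hcd))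
    (by rw [hE.edist_eq]; exact plane _ _ _ _ _ hC0
          (by linear_combination B ^ 2 * hcd - hcAB))
    (by rw [hE.edist_eq]; exact plane _ _ _ _ _ hε0 (by ring))
    (by rw [hE.edist_eq, hxq]; exact plane _ _ _ _ _ hxq0 (by ring))
    (by rw [hE.edist_eq]; exact plane _ _ _ _ _ hs0 (by linear_combination s ^ 2 * hcd))
    (by rw [hE.edist_eq, hyr]; exact plane _ _ _ _ _ hyr0
          (by linear_combination (B - s) ^ 2 * hcd))
  rw [plane _ _ _ _ (Real.sqrt m) (Real.sqrt_nonneg _)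
    (by rw [Real.sq_sqrt hm0]; linear_combination s ^ 2 * hcd), hE.edist_eq,
    ENNReal.ofReal_le_ofReal_iff (Real.sqrt_nonneg _)] at this
  have h2 : realDist x y ^ 2 ≤ m := by
    calc _ ≤ Real.sqrt m ^ 2 := pow_le_pow_left₀ (realDist_nonneg _ _) this 2
      _ = m := Real.sq_sqrt hm0
  refine h2.trans_eq ?_
  rw [hm, hc]
  field_simp

/-- The distance to a point is strictly convex in the middle of a geodesic. -/
theorem realDist_lt_max {p m q r : E} {h : ℝ} (hh : 0 < h) (hpm : realDist p m = h)
    (hmq : realDist m q = h) (hpq : realDist p q = 2 * h) :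
    realDist m r < max (realDist p r) (realDist q r) := by
  -- The law of cosines at `p` divides by the distance from `p` to `r`, so `r = p` is separate.
  -- Otherwise it becomes the median inequality with the gain `h ^ 2`.
  rcases (realDist_nonneg p r).eq_or_lt with h0 | h0
  · have := hE.realDist_triangle p q r
    have h1 := hE.realDist_triangle m p r
    rw [realDist_comm m p] at h1
    exact lt_max_of_lt_right (by
      have := hE.realDist_triangle p r q
      rw [realDist_comm r q] at this
      linarith)
  · have key := hE.realDist_sq_le (p := p) (q := q) (r := r) (x := m) (y := r) (by linarith) h0
      (by linarith) (by rw [realDist_self, add_zero])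
    rw [hpm, hpq] at key
    set B := realDist p r
    set C := realDist q r
    have e : h ^ 2 + B ^ 2 - h * B * (((2 * h) ^ 2 + B ^ 2 - C ^ 2) / (2 * h * B)) =
        (B ^ 2 + C ^ 2) / 2 - h ^ 2 := by
      field_simp; ring
    rw [e] at key
    have hB : B ≤ max B C := le_max_left _ _
    have hC : C ≤ max B C := le_max_right _ _
    have hC0 : 0 ≤ C := realDist_nonneg _ _
    refine lt_of_pow_lt_pow_left₀ 2 (le_max_of_le_left h0.le) ?_
    have := pow_le_pow_left₀ h0.le hB 2
    have := pow_le_pow_left₀ hC0 hC 2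
    nlinarith

/-- A point at a given distance on a geodesic. -/
theorem exists_realDist_eq {p q : E} {a : ℝ} (h0 : 0 ≤ a) (h1 : a ≤ realDist p q) :
    ∃ x, realDist p x = a ∧ realDist p x + realDist x q = realDist p q := by
  obtain ⟨L, γ, hL, rfl, rfl, hγ⟩ := hE.exists_geodesic p q
  have hd : ∀ s ∈ Set.Icc 0 L, ∀ t ∈ Set.Icc 0 L, realDist (γ s) (γ t) = |s - t| := by
    intro s hs t ht
    rw [realDist, hγ s hs t ht, ENNReal.toReal_ofReal (abs_nonneg _)]
  have z : (0 : ℝ) ∈ Set.Icc 0 L := ⟨le_rfl, hL⟩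
  have l : L ∈ Set.Icc 0 L := ⟨hL, le_rfl⟩
  rw [hd 0 z L l, zero_sub, abs_neg, abs_of_nonneg hL] at h1
  have ha : a ∈ Set.Icc 0 L := ⟨h0, h1⟩
  refine ⟨γ a, ?_, ?_⟩
  · rw [hd 0 z a ha, zero_sub, abs_neg, abs_of_nonneg h0]
  · rw [hd 0 z a ha, hd a ha L l, hd 0 z L l, zero_sub, zero_sub, abs_neg, abs_neg,
      abs_of_nonneg h0, abs_of_nonneg hL, abs_of_nonpos (by linarith)]
    ring

end IsCAT0Space

end RealDistance

/-! ### Coordinates near a vertex -/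

namespace CubeComplex

variable {V : Type*} {X : CubeComplex V}

/-- The coordinate along the edge `{v,a}` of a point in the open star of `v`. -/
def starCoord (v : V) (m : V →₀ ℝ) (a : V) : ℝ := m a / (m v + m a)

/-- The coordinates along finitely many edges of a point in the open star of `v`. -/
def starVec (v : V) (A : Finset V) (m : V →₀ ℝ) : EuclideanSpace ℝ A :=
  WithLp.toLp 2 fun a => starCoord v m a

theorem dist_starVec_sq (v : V) (A : Finset V) (m m' : V →₀ ℝ) :
    dist (starVec v A m) (starVec v A m') ^ 2 =
      ∑ a ∈ A, (starCoord v m a - starCoord v m' a) ^ 2 := by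
  rw [EuclideanSpace.dist_eq, Real.sq_sqrt (Finset.sum_nonneg fun i _ => sq_nonneg _),
    ← Finset.sum_coe_sort A]
  simp [starVec, Real.dist_eq, sq_abs]

theorem starCoord_eq_zero {v a : V} {m : V →₀ ℝ} (h : m a = 0) : starCoord v m a = 0 := by
  simp [starCoord, h]

/-- The weights of the two ends of an edge at `φ f` have all factors but one in common, so their
ratio determines the coordinate along this edge, measured from `φ f`, independently of the chart. -/
theorem IsChart.starCoord_flipAt {n : ℕ} {φ : (Fin n → Bool) → V} (h : X.IsChart φ)
    {t : EuclideanSpace ℝ (Fin n)} {f : Fin n → Bool} (h0 : cubePoint φ t (φ f) ≠ 0)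
    (i : Fin n) : starCoord (φ f) (cubePoint φ t) (φ (flipAt f i)) =
      1 - sideWeight (f i) (t i) := by
  rw [cubePoint_apply_eq_mul h.injective t f i] at h0
  rw [starCoord, cubePoint_apply_eq_mul h.injective t f i, cubePoint_flipAt h.injective t f i]
  have := right_ne_zero_of_mul h0
  field_simp
  ring

/-- In one cube the star coordinates at a vertex are the Euclidean ones up to reflections, and edges
that leave the cube contribute `0`. -/
theorem Step.dist_starVec_le {p q : X.Realization} {ℓ : ℝ} (hstep : X.Step p q ℓ) {v : V}
    (hp : p.1 v ≠ 0) (hq : q.1 v ≠ 0) {A : Finset V} (hA : ∀ a ∈ A, X.graph.Adj v a) :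
    dist (starVec v A p.1) (starVec v A q.1) ≤ ℓ := by
  classical
  obtain ⟨n, φ, h, s, hs, t, ht, hps, hqt, rfl⟩ := hstep.exists_chart
  rw [hps] at hp ⊢
  rw [hqt] at hq ⊢
  obtain ⟨f, rfl⟩ := exists_of_cubePoint_ne_zero hp
  refine le_of_sq_le_sq ?_ dist_nonneg
  rw [dist_starVec_sq, dist_sq_eq_sum]
  set F : V → ℝ := fun a => (starCoord (φ f) (cubePoint φ s) a -
    starCoord (φ f) (cubePoint φ t) a) ^ 2
  have hF : ∀ i, F (φ (flipAt f i)) = (s i - t i) ^ 2 := by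
    intro i
    simp only [F]
    rw [h.starCoord_flipAt hp, h.starCoord_flipAt hq, ← sq_sideWeight_sub (f i) (s i) (t i)]
    ring
  set B := Finset.univ.image fun i => φ (flipAt f i)
  calc ∑ a ∈ A, F a ≤ ∑ a ∈ A ∪ B, F a :=
        Finset.sum_le_sum_of_subset_of_nonneg Finset.subset_union_left
          fun _ _ _ => sq_nonneg _
    _ = ∑ a ∈ B, F a := by
        refine (Finset.sum_subset Finset.subset_union_right fun a ha hB => ?_).symm
        have haA : a ∈ A := (Finset.mem_union.1 ha).resolve_right hB
        have hr : a ∉ Set.range φ := by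
          intro hr
          obtain ⟨i, rfl⟩ := h.exists_flipAt_of_adj (hA a haA) hr
          exact hB (Finset.mem_image_of_mem _ (Finset.mem_univ i))
        simp only [F]
        rw [starCoord_eq_zero (cubePoint_apply_of_notMem hr _),
          starCoord_eq_zero (cubePoint_apply_of_notMem hr _)]
        simp
    _ = ∑ i, (s i - t i) ^ 2 := by
        rw [Finset.sum_image fun i _ j _ e => flipAt_injective f (h.injective e)]
        exact Finset.sum_congr rfl fun i _ => hF i

/-- The weight of `v` is a product, so it vanishes only where some coordinate reaches the side
opposite to `v`. The step covers what is left of this coordinate. -/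
theorem Step.exists_le_of_eq_zero {p q : X.Realization} {ℓ : ℝ} (hstep : X.Step p q ℓ) {v : V}
    (hp : p.1 v ≠ 0) (hq : q.1 v = 0) :
    ∃ a, X.graph.Adj v a ∧ 1 - starCoord v p.1 a ≤ ℓ := by
  obtain ⟨n, φ, h, s, hs, t, ht, hps, hqt, rfl⟩ := hstep.exists_chart
  rw [hps] at hp ⊢
  rw [hqt] at hq
  obtain ⟨f, rfl⟩ := exists_of_cubePoint_ne_zero hp
  rw [cubePoint_apply h.injective, Finset.prod_eq_zero_iff] at hq
  obtain ⟨i, -, hi⟩ := hq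
  refine ⟨_, h.adj_flipAt f i, ?_⟩
  rw [h.starCoord_flipAt hp]
  refine le_trans (le_abs_self _) (le_trans ?_ (abs_coord_sub_le_dist s t i))
  apply sq_le_sq.1
  rw [← sq_sideWeight_sub (f i) (s i) (t i), hi]
  apply le_of_eq; ring

/-- A path that starts in the open star of `v` stays there and is at least as long as the
difference of the coordinates, or has to cross the rest of an edge at `v`. -/
theorem PLPath.starVec {p q : X.Realization} {ℓ : ℝ} (h : X.PLPath p q ℓ) {v : V}
    (hp : p.1 v ≠ 0) {A : Finset V} (hA : ∀ a ∈ A, X.graph.Adj v a) :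
    (q.1 v ≠ 0 ∧ dist (starVec v A p.1) (starVec v A q.1) ≤ ℓ) ∨
      ∃ a, X.graph.Adj v a ∧ 1 - starCoord v p.1 a ≤ ℓ := by
  induction h with
  | nil p => exact Or.inl ⟨hp, by simp⟩
  | @cons p r q a b hs hpath ih =>
    by_cases hr : r.1 v = 0
    · obtain ⟨c, hc, hle⟩ := hs.exists_le_of_eq_zero hp hr
      exact Or.inr ⟨c, hc, by linarith [hpath.nonneg]⟩
    · rcases ih hr with ⟨hq, hd⟩ | ⟨c, hc, hle⟩
      · exact Or.inl ⟨hq, (dist_triangle _ _ _).trans (add_le_add (hs.dist_starVec_le hp hr hA) hd)⟩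
      · refine Or.inr ⟨c, hc, ?_⟩
        -- The escape bound starts at `r`; the first step changes the coordinate along the escape
        -- edge by at most its own length.
        have := hs.dist_starVec_le hp hr (A := {c}) (by simpa using hc)
        have h2 : |starCoord v p.1 c - starCoord v r.1 c| ≤ a := by
          refine le_trans (abs_le_of_sq_le_sq ?_ dist_nonneg) this
          rw [dist_starVec_sq]; simp
        have := (abs_le.1 h2).2
        have := (abs_le.1 h2).1
        linarith

/-! ### The distance in the realization -/

theorem edist_le_of_plPath {p q : X.Realization} {ℓ : ℝ} (h : X.PLPath p q ℓ) :
    edist p q ≤ ENNReal.ofReal ℓ := iInf₂_le ℓ h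

theorem realDist_le_of_plPath {p q : X.Realization} {ℓ : ℝ} (h : X.PLPath p q ℓ) :
    realDist p q ≤ ℓ :=
  ENNReal.toReal_le_of_le_ofReal h.nonneg (edist_le_of_plPath h)

theorem le_realDist (hX : X.IsCAT0) {p q : X.Realization} {c : ℝ}
    (h : ∀ ℓ, X.PLPath p q ℓ → c ≤ ℓ) : c ≤ realDist p q := by
  have : ENNReal.ofReal c ≤ edist p q := le_iInf₂ fun ℓ hℓ => ENNReal.ofReal_le_ofReal (h ℓ hℓ)
  rw [IsCAT0Space.edist_eq hX] at this
  exact (ENNReal.ofReal_le_ofReal_iff (realDist_nonneg _ _)).1 this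

theorem exists_plPath (hX : X.IsCAT0) (p q : X.Realization) : ∃ ℓ, X.PLPath p q ℓ := by
  by_contra h
  push Not at h
  refine IsCAT0Space.edist_ne_top hX p q (top_le_iff.1 ?_)
  exact le_iInf₂ fun ℓ hℓ => absurd hℓ (h ℓ)

theorem IsChart.realDist_le {n : ℕ} {φ : (Fin n → Bool) → V} (h : X.IsChart φ)
    {s t : EuclideanSpace ℝ (Fin n)} (hs : s ∈ unitCube n) (ht : t ∈ unitCube n)
    {p q : X.Realization} (hp : p.1 = cubePoint φ s) (hq : q.1 = cubePoint φ t) :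
    realDist p q ≤ dist s t :=
  realDist_le_of_plPath (h.step hs ht hp hq).plPath

theorem one_le_realDist_vertex (hX : X.IsCAT0) {u v : V} (h : u ≠ v) :
    1 ≤ realDist (X.vertex u) (X.vertex v) := by
  refine le_realDist hX fun ℓ hℓ => ?_
  rcases hℓ.starVec (v := u) (A := ∅) (by simp [vertex]) (by simp) with ⟨h1, -⟩ | ⟨a, ha, hle⟩
  · exact absurd (by simp [vertex, h.symm]) h1
  · rwa [starCoord_eq_zero (by simp [vertex, ha.1]), sub_zero] at hle

/-- Consecutive points share a cube, and the vertices of a cube are joined by edges. A nearest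
vertex of the next point carries the induction, having positive weight. -/
theorem reachable_of_plPath {p q : X.Realization} {ℓ : ℝ} (h : X.PLPath p q ℓ) {a b : V}
    (ha : p.1 a ≠ 0) (hb : q.1 b ≠ 0) : X.graph.Reachable a b := by
  induction h generalizing a with
  | nil p =>
    obtain ⟨n, φ, h, t, ht, hpt⟩ := p.exists_chart
    obtain ⟨f, rfl⟩ := exists_of_cubePoint_ne_zero (hpt ▸ ha)
    obtain ⟨g, rfl⟩ := exists_of_cubePoint_ne_zero (hpt ▸ hb)
    exact h.reachable f g
  | @cons p r q c d hs hpath ih =>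
    obtain ⟨n, φ, h, s, hs, t, ht, hps, hrt, rfl⟩ := hs.exists_chart
    obtain ⟨f, rfl⟩ := exists_of_cubePoint_ne_zero (hps ▸ ha)
    obtain ⟨g, hg⟩ := exists_half_le_sideWeight t
    refine (h.reachable f g).trans (ih ?_ hb)
    rw [hrt, cubePoint_apply h.injective]
    exact (Finset.prod_pos fun j _ => by linarith [hg j]).ne'

theorem reachable (hX : X.IsCAT0) (a b : V) : X.graph.Reachable a b := by
  obtain ⟨ℓ, hℓ⟩ := exists_plPath hX (X.vertex a) (X.vertex b)
  exact reachable_of_plPath hℓ (by simp [vertex]) (by simp [vertex])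

/-! ### Monotonicity of the distance to a vertex along the edges of a cube -/

variable (X) in
/-- The distance of a point of the realization to a vertex. -/
def height (x : V) (p : X.Realization) : ℝ := realDist p (X.vertex x)

/-- In the interior of a cube, the height is greater than on one of the sides. -/
theorem exists_height_lt (hX : X.IsCAT0) (x : V) {n : ℕ} {φ : (Fin n → Bool) → V}
    (h : X.IsChart φ) {t : EuclideanSpace ℝ (Fin n)} (ht : t ∈ unitCube n) {i : Fin n}
    (h0 : 0 < t i) (h1 : t i < 1) : ∃ e : Bool,
    X.height x (h.point (setCoord t i (endpoint e)) (setCoord_mem ht i (endpoint_mem e))) <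
      X.height x (h.point t ht) := by
  by_contra hcon
  push Not at hcon
  set k := min (t i) (1 - t i) with hk
  have hk0 : 0 < k := lt_min h0 (by linarith)
  set D := X.height x (h.point t ht) with hD
  have hD0 : 0 ≤ D := realDist_nonneg _ _
  -- If both projections were at least as high, each path to `x` would, by projection, have length
  -- at least `sqrt (D ^ 2 + k ^ 2)`, where `k` is the distance to the nearer side.
  have : Real.sqrt (D ^ 2 + k ^ 2) ≤ D := by
    refine le_realDist hX fun ℓ hℓ => ?_
    obtain ⟨e, p', ℓ', hp', hpath, hle⟩ := hℓ.project rfl h ht rfl i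
    rw [Real.sqrt_le_left hℓ.nonneg]
    have e1 : p' = h.point (setCoord t i (endpoint e)) (setCoord_mem ht i (endpoint_mem e)) :=
      Subtype.ext hp'
    have e2 : D ≤ ℓ' := (hcon e).trans (by rw [← e1]; exact realDist_le_of_plPath hpath)
    have e3 : k ^ 2 ≤ (t i - endpoint e) ^ 2 := by
      rw [← sq_abs (t i - _)]
      refine pow_le_pow_left₀ hk0.le ?_ 2
      cases e
      · simp [endpoint, abs_of_pos h0, hk]
      · simp only [endpoint, if_true]
        rw [abs_of_neg (by linarith), hk]
        exact (min_le_right _ _).trans (by linarith)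
    have := pow_le_pow_left₀ hD0 e2 2
    linarith
  rw [Real.sqrt_le_left hD0] at this
  nlinarith

/-- Close points on a segment parallel to an edge have their Euclidean distance. -/
theorem IsChart.le_realDist (hX : X.IsCAT0) {n : ℕ} {φ : (Fin n → Bool) → V} (h : X.IsChart φ)
    {t : EuclideanSpace ℝ (Fin n)} {i : Fin n} {r r' : ℝ}
    (hr : 0 ≤ r) (hrr : r ≤ r') (h1 : r' < 1) (h2 : r' - r ≤ 1 / 2) {p q : X.Realization}
    (hp : p.1 = cubePoint φ (setCoord t i r)) (hq : q.1 = cubePoint φ (setCoord t i r')) :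
    r' - r ≤ realDist p q := by
  obtain ⟨f0, hf0⟩ := exists_half_le_sideWeight t
  -- Both points lie in the open star of this vertex, and their star coordinates in direction `i`
  -- are `r` and `r'`. A path that leaves the star is no shorter than `r' - r`: it covers at least
  -- `1 - r` in direction `i`, or at least `1 / 2` in another one.
  set f := Function.update f0 i false with hf
  have fi : f i = false := by simp [hf]
  have fj : ∀ j, j ≠ i → 1 / 2 ≤ sideWeight (f j) (t j) := by
    intro j hj
    rw [hf, Function.update_of_ne hj]; exact hf0 j
  have wt : ∀ c : ℝ, c < 1 → cubePoint φ (setCoord t i c) (φ f) ≠ 0 := by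
    intro c hc
    rw [cubePoint_apply h.injective]
    refine (Finset.prod_pos fun j _ => ?_).ne'
    by_cases hj : j = i
    · subst hj; rw [setCoord_same, fi]; simp [sideWeight, hc]
    · rw [setCoord_of_ne _ hj]; linarith [fj j hj]
  refine CubeComplex.le_realDist hX fun ℓ hℓ => ?_
  have hA : ∀ a ∈ ({φ (flipAt f i)} : Finset V), X.graph.Adj (φ f) a := by
    simpa using h.adj_flipAt f i
  rcases hℓ.starVec (v := φ f) (by rw [hp]; exact wt r (by linarith)) hA with
    ⟨-, hd⟩ | ⟨a, ha, hle⟩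
  · refine le_trans (le_of_sq_le_sq ?_ dist_nonneg) hd
    rw [dist_starVec_sq, Finset.sum_singleton, hp, hq,
      h.starCoord_flipAt (wt r (by linarith)), h.starCoord_flipAt (wt r' h1), fi, setCoord_same,
      setCoord_same]
    apply le_of_eq; simp [sideWeight]; ring
  · refine le_trans ?_ hle
    rw [hp]
    by_cases har : a ∈ Set.range φ
    · obtain ⟨j, rfl⟩ := h.exists_flipAt_of_adj ha har
      rw [h.starCoord_flipAt (wt r (by linarith))]
      by_cases hj : j = i
      · subst hj; rw [setCoord_same, fi]; simp [sideWeight]; linarith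
      · rw [setCoord_of_ne _ hj]; linarith [fj j hj]
    · rw [starCoord_eq_zero (cubePoint_apply_of_notMem har _)]; linarith

theorem abs_height_sub_le (hX : X.IsCAT0) (x : V) {n : ℕ} {φ : (Fin n → Bool) → V}
    (h : X.IsChart φ) {s t : EuclideanSpace ℝ (Fin n)} (hs : s ∈ unitCube n)
    (ht : t ∈ unitCube n) :
    |X.height x (h.point s hs) - X.height x (h.point t ht)| ≤ dist s t := by
  have h1 := h.realDist_le hs ht (p := h.point s hs) (q := h.point t ht) rfl rfl
  have h2 := IsCAT0Space.realDist_triangle hX (h.point s hs) (h.point t ht) (X.vertex x)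
  have h3 := IsCAT0Space.realDist_triangle hX (h.point t ht) (h.point s hs) (X.vertex x)
  rw [realDist_comm (h.point t ht) (h.point s hs)] at h3
  rw [abs_le]
  constructor <;> simp only [height] <;> linarith

/-- The height has no interior maximum on a segment parallel to an edge. -/
theorem exists_lt_height (hX : X.IsCAT0) (x : V) {n : ℕ} {φ : (Fin n → Bool) → V}
    (h : X.IsChart φ) {t : EuclideanSpace ℝ (Fin n)} (ht : t ∈ unitCube n) {i : Fin n}
    {r : ℝ} (h0 : 0 < r) (h1 : r < 1) : ∃ (r' : ℝ) (hr : 0 ≤ r' ∧ r' ≤ 1),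
    X.height x (h.point (setCoord t i r) (setCoord_mem ht i ⟨h0.le, h1.le⟩)) <
      X.height x (h.point (setCoord t i r') (setCoord_mem ht i hr)) := by
  -- Three equidistant points of the segment with mutual distances at most `1 / 2` and last
  -- coordinate below `1`, so that their distances in the realization are the Euclidean ones.
  obtain ⟨k, hk0, hk1, hk2, hk3⟩ : ∃ k : ℝ, 0 < k ∧ k ≤ 1 / 4 ∧ k ≤ r ∧ k < 1 - r :=
    ⟨min (1 / 4) (min (r / 2) ((1 - r) / 2)),
      lt_min (by norm_num) (lt_min (by linarith) (by linarith)), min_le_left _ _,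
      ((min_le_right _ _).trans (min_le_left _ _)).trans (by linarith),
      ((min_le_right _ _).trans (min_le_right _ _)).trans_lt (by linarith)⟩
  have hm : 0 ≤ r - k ∧ r - k ≤ 1 := ⟨by linarith, by linarith⟩
  have hp : 0 ≤ r + k ∧ r + k ≤ 1 := ⟨by linarith, by linarith⟩
  set P := h.point (setCoord t i (r - k)) (setCoord_mem ht i hm)
  set M := h.point (setCoord t i r) (setCoord_mem ht i ⟨h0.le, h1.le⟩)
  set Q := h.point (setCoord t i (r + k)) (setCoord_mem ht i hp)
  have d1 : realDist P M = k := by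
    apply le_antisymm
    · refine (h.realDist_le (setCoord_mem ht i hm) (setCoord_mem ht i ⟨h0.le, h1.le⟩)
        rfl rfl).trans_eq ?_
      rw [dist_setCoord, abs_of_neg (by linarith)]; ring
    · exact le_of_eq_of_le (by ring) (h.le_realDist hX (t := t) (i := i) (r := r - k) (r' := r)
        (by linarith) (by linarith) (by linarith) (by linarith) rfl rfl)
  have d2 : realDist M Q = k := by
    apply le_antisymm
    · refine (h.realDist_le (setCoord_mem ht i ⟨h0.le, h1.le⟩) (setCoord_mem ht i hp)
        rfl rfl).trans_eq ?_
      rw [dist_setCoord, abs_of_neg (by linarith)]; ring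
    · exact le_of_eq_of_le (by ring) (h.le_realDist hX (t := t) (i := i) (r := r) (r' := r + k)
        (by linarith) (by linarith) (by linarith) (by linarith) rfl rfl)
  have d3 : realDist P Q = 2 * k := by
    apply le_antisymm
    · linarith [IsCAT0Space.realDist_triangle hX P M Q]
    · exact le_of_eq_of_le (by ring) (h.le_realDist hX (t := t) (i := i) (r := r - k) (r' := r + k)
        (by linarith) (by linarith) (by linarith) (by linarith) rfl rfl)
  rcases lt_max_iff.1 (IsCAT0Space.realDist_lt_max hX (r := X.vertex x) hk0 d1 d2 d3) with hh | hh
  · exact ⟨_, hm, hh⟩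
  · exact ⟨_, hp, hh⟩

/-- With equal heights at the ends, minimum and maximum over the segment would both be taken at the
ends, as neither can occur inside. So the height would be constant on the segment, which the absence
of an inner maximum forbids. -/
theorem height_side_ne (hX : X.IsCAT0) (x : V) {n : ℕ} {φ : (Fin n → Bool) → V}
    (h : X.IsChart φ) {t : EuclideanSpace ℝ (Fin n)} (ht : t ∈ unitCube n) (i : Fin n) :
    X.height x (h.point (setCoord t i (endpoint true)) (setCoord_mem ht i (endpoint_mem _))) ≠
    X.height x (h.point (setCoord t i (endpoint false)) (setCoord_mem ht i (endpoint_mem _))) := by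
  intro heq
  set f : Set.Icc (0 : ℝ) 1 → ℝ := fun r =>
    X.height x (h.point (setCoord t i r) (setCoord_mem ht i r.2)) with hf
  have hlip : ∀ r s, |f r - f s| ≤ |(r : ℝ) - s| := by
    intro r s
    refine (abs_height_sub_le hX x h _ _).trans_eq ?_
    rw [dist_setCoord]
  have hcont : Continuous f := by
    refine (LipschitzWith.of_dist_le_mul (K := 1) fun r s => ?_).continuous
    rw [NNReal.coe_one, one_mul, Real.dist_eq]
    exact hlip r s
  let e0 : Set.Icc (0 : ℝ) 1 := ⟨endpoint false, endpoint_mem _⟩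
  let e1 : Set.Icc (0 : ℝ) 1 := ⟨endpoint true, endpoint_mem _⟩
  have hend : f e1 = f e0 := heq
  obtain ⟨a, -, ha⟩ := isCompact_univ.exists_isMinOn ⟨e0, Set.mem_univ _⟩ hcont.continuousOn
  obtain ⟨b, -, hb⟩ := isCompact_univ.exists_isMaxOn ⟨e0, Set.mem_univ _⟩ hcont.continuousOn
  have ha' : ∀ r, f a ≤ f r := fun r => ha (Set.mem_univ r)
  have hb' : ∀ r, f r ≤ f b := fun r => hb (Set.mem_univ r)
  have cases : ∀ r : Set.Icc (0 : ℝ) 1, r = e0 ∨ r = e1 ∨ (0 < (r : ℝ) ∧ (r : ℝ) < 1) := by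
    intro r
    rcases r.2.1.eq_or_lt with h' | h'
    · exact Or.inl (Subtype.ext (by simp [e0, endpoint, ← h']))
    rcases r.2.2.eq_or_lt with h'' | h''
    · exact Or.inr (Or.inl (Subtype.ext (by simp [e1, endpoint, ← h''])))
    exact Or.inr (Or.inr ⟨h', h''⟩)
  have hmin : f a = f e0 := by
    rcases cases a with rfl | rfl | ⟨h0, h1⟩
    · rfl
    · exact hend
    · exfalso
      obtain ⟨e, he⟩ := exists_height_lt hX x h (setCoord_mem ht i a.2) (i := i)
        (by rwa [setCoord_same]) (by rwa [setCoord_same])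
      have hs : setCoord (setCoord t i a) i (endpoint e) = setCoord t i (endpoint e) := by
        simp [setCoord]
      simp only [hs] at he
      exact absurd he (not_lt.2 (ha' ⟨endpoint e, endpoint_mem e⟩))
  have hmax : f b = f e0 := by
    rcases cases b with rfl | rfl | ⟨h0, h1⟩
    · rfl
    · exact hend
    · exfalso
      obtain ⟨r, hr, hlt⟩ := exists_lt_height hX x h ht (i := i) h0 h1
      exact absurd hlt (not_lt.2 (hb' ⟨r, hr⟩))
  obtain ⟨r, hr, hlt⟩ := exists_lt_height hX x h ht (i := i) (r := 1 / 2) (by norm_num)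
    (by norm_num)
  have h3 := ha' ⟨1 / 2, by norm_num, by norm_num⟩
  have h4 := hb' ⟨r, hr⟩
  have : f ⟨1 / 2, by norm_num, by norm_num⟩ < f ⟨r, hr⟩ := hlt
  linarith

variable (X) in
/-- The distance of two vertices in the realization. -/
def vertexHeight (x v : V) : ℝ := X.height x (X.vertex v)

theorem IsChart.height_corner {n : ℕ} {φ : (Fin n → Bool) → V} (h : X.IsChart φ) (x : V)
    (f : Fin n → Bool) {t : EuclideanSpace ℝ (Fin n)} (ht : t ∈ unitCube n) (e : t = corner f) :
    X.height x (h.point t ht) = X.vertexHeight x (φ f) := by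
  subst e
  have : h.point (corner f) ht = X.vertex (φ f) := Subtype.ext (h.vertex_eq f).symm
  rw [this]; rfl

theorem unitCube_convex (n : ℕ) : Convex ℝ (unitCube n) := by
  intro s hs t ht a b ha hb hab i
  have h1 := hs i
  have h2 := ht i
  simp only [PiLp.add_apply, PiLp.smul_apply, smul_eq_mul]
  constructor
  · nlinarith
  · nlinarith

/-- Parallel edges of a cube are oriented in the same way by the height. -/
theorem height_lt_iff_of_isChart (hX : X.IsCAT0) (x : V) {n : ℕ} {φ : (Fin n → Bool) → V}
    (h : X.IsChart φ) {f g : Fin n → Bool} {i : Fin n} (hfg : f i = g i) :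
    X.vertexHeight x (φ (flipAt f i)) < X.vertexHeight x (φ f) ↔
      X.vertexHeight x (φ (flipAt g i)) < X.vertexHeight x (φ g) := by
  -- The difference of the heights of the two projections in direction `i` is continuous and never
  -- `0` on the connected cube, so it has one sign. At the corners it compares the ends of parallel
  -- edges.
  set F : unitCube n → ℝ := fun t =>
    X.height x (h.point (setCoord t.1 i (endpoint (!f i)))
      (setCoord_mem t.2 i (endpoint_mem _))) -
    X.height x (h.point (setCoord t.1 i (endpoint (f i)))
      (setCoord_mem t.2 i (endpoint_mem _))) with hF
  have hne : ∀ t, F t ≠ 0 := by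
    intro t
    have := height_side_ne hX x h t.2 i
    simp only [hF]
    cases f i
    · exact sub_ne_zero.2 this
    · exact sub_ne_zero.2 this.symm
  have hlip : LipschitzWith 2 F := by
    refine LipschitzWith.of_dist_le_mul fun s t => ?_
    have key : ∀ r, dist (setCoord s.1 i r) (setCoord t.1 i r) ≤ dist s t := by
      intro r
      refine le_of_sq_le_sq ?_ dist_nonneg
      have := dist_setCoord_sq s.1 t.1 i r
      change _ ≤ dist s.1 t.1 ^ 2
      nlinarith [sq_nonneg (s.1 i - t.1 i)]
    have k1 := (abs_height_sub_le hX x h (setCoord_mem s.2 i (endpoint_mem (!f i)))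
      (setCoord_mem t.2 i (endpoint_mem (!f i)))).trans (key _)
    have k2 := (abs_height_sub_le hX x h (setCoord_mem s.2 i (endpoint_mem (f i)))
      (setCoord_mem t.2 i (endpoint_mem (f i)))).trans (key _)
    rw [Real.dist_eq]
    simp only [hF, NNReal.coe_ofNat]
    rw [abs_le] at k1 k2 ⊢
    constructor <;> linarith [k1.1, k1.2, k2.1, k2.2]
  have hval : ∀ c : Fin n → Bool, c i = f i → F ⟨corner c, corner_mem c⟩ =
      X.vertexHeight x (φ (flipAt c i)) - X.vertexHeight x (φ c) := by
    intro c hc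
    simp only [hF]
    rw [h.height_corner x (flipAt c i) _ (by rw [← hc, setCoord_corner]),
      h.height_corner x c _ (by rw [← hc, ← corner_apply, setCoord_self])]
  have hconn : PreconnectedSpace (unitCube n) :=
    Subtype.preconnectedSpace (unitCube_convex n).isPreconnected
  have sgn : ∀ s t, F s < 0 → F t < 0 := by
    intro s t hs
    by_contra ht
    push Not at ht
    obtain ⟨r, hr⟩ := mem_range_of_exists_le_of_exists_ge hlip.continuous ⟨s, hs.le⟩ ⟨t, ht⟩
    exact hne r hr
  have h1 := hval f rfl
  have h2 := hval g hfg.symm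
  rw [← sub_neg, ← h1, ← sub_neg (b := X.vertexHeight x (φ g)), ← h2]
  exact ⟨sgn _ _, sgn _ _⟩

theorem exists_isChart_of_adj {v a : V} (h : X.graph.Adj v a) :
    ∃ (n : ℕ) (φ : (Fin n → Bool) → V) (f : Fin n → Bool) (i : Fin n), X.IsChart φ ∧
      φ f = v ∧ φ (flipAt f i) = a := by
  obtain ⟨n, φ, hφ, hr⟩ := exists_isChart h.2
  obtain ⟨f, rfl⟩ : v ∈ Set.range φ := hr ▸ Or.inl rfl
  obtain ⟨i, hi⟩ := hφ.exists_flipAt_of_adj h (hr ▸ Or.inr rfl)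
  exact ⟨n, φ, f, i, hφ, rfl, hi.symm⟩

theorem vertexHeight_ne (hX : X.IsCAT0) (x : V) {v a : V} (h : X.graph.Adj v a) :
    X.vertexHeight x v ≠ X.vertexHeight x a := by
  obtain ⟨n, φ, f, i, hφ, rfl, rfl⟩ := exists_isChart_of_adj h
  have := height_side_ne hX x hφ (corner_mem f) i
  have h1 := hφ.height_corner x f (setCoord_mem (corner_mem f) i (endpoint_mem (f i)))
    (by rw [← corner_apply, setCoord_self])
  have h2 := hφ.height_corner x (flipAt f i)
    (setCoord_mem (corner_mem f) i (endpoint_mem (!f i))) (setCoord_corner f i)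
  rw [← h1, ← h2]
  have key : ∀ e : Bool, X.height x (hφ.point (setCoord (corner f) i (endpoint e))
      (setCoord_mem (corner_mem f) i (endpoint_mem e))) ≠
      X.height x (hφ.point (setCoord (corner f) i (endpoint (!e)))
        (setCoord_mem (corner_mem f) i (endpoint_mem _))) := by
    rintro (_ | _)
    · exact this.symm
    · exact this
  exact key (f i)

theorem vertexHeight_self (x : V) : X.vertexHeight x x = 0 := realDist_self _

/-- The lower neighbors of a vertex lie in a common cube. -/
theorem exists_chart_of_height_lt (hX : X.IsCAT0) {x v : V} (hv : v ≠ x) :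
    ∃ (n : ℕ) (φ : (Fin n → Bool) → V) (f : Fin n → Bool), X.IsChart φ ∧ φ f = v ∧
      ∀ a, X.graph.Adj v a → X.vertexHeight x a < X.vertexHeight x v →
        ∃ i, a = φ (flipAt f i) := by
  classical
  set D := X.vertexHeight x v with hD
  have hD1 : 1 ≤ D := one_le_realDist_vertex hX hv
  -- Any distance below `1` keeps `q` in the open star of `v`. A cube that contains `q` then
  -- contains `v`, and it is the cube sought.
  obtain ⟨q, hq1, hq2⟩ := IsCAT0Space.exists_realDist_eq hX (p := X.vertex v) (q := X.vertex x)
    (a := 1 / 4) (by norm_num) (by change _ ≤ D; linarith)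
  have hqv : q.1 v ≠ 0 := by
    intro h0
    have : (1 : ℝ) ≤ realDist (X.vertex v) q := by
      refine le_realDist hX fun ℓ hℓ => ?_
      rcases hℓ.starVec (v := v) (A := ∅) (by simp [vertex]) (by simp) with ⟨h1, -⟩ | ⟨a, ha, hle⟩
      · exact absurd h0 h1
      · rwa [starCoord_eq_zero (by simp [vertex, ha.1]), sub_zero] at hle
    linarith
  obtain ⟨n, φ, h, t, ht, hqt⟩ := q.exists_chart
  rw [hqt] at hqv
  obtain ⟨f, rfl⟩ := exists_of_cubePoint_ne_zero hqv
  refine ⟨n, φ, f, h, rfl, fun a ha hlt => ?_⟩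
  refine h.exists_flipAt_of_adj ha ?_
  by_contra har
  have hqa : starCoord (φ f) (cubePoint φ t) a = 0 :=
    starCoord_eq_zero (cubePoint_apply_of_notMem har t)
  obtain ⟨k, ψ, g, j, h', hg, hj⟩ := exists_isChart_of_adj ha
  have hmem : (0 : ℝ) ≤ sideWeight (!g j) (1 / 4) ∧ sideWeight (!g j) (1 / 4) ≤ 1 :=
    sideWeight_mem _ (by norm_num)
  -- The point of the edge `{v,a}` at distance `1 / 4` from `v`.
  set s := setCoord (corner g) j (sideWeight (!g j) (1 / 4)) with hs
  have hsm : s ∈ unitCube k := setCoord_mem (corner_mem g) j hmem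
  set y := h'.point s hsm with hy
  have dvy : realDist (X.vertex (φ f)) y ≤ 1 / 4 := by
    refine (h'.realDist_le (corner_mem g) hsm (by rw [← hg]; exact h'.vertex_eq g) rfl).trans_eq ?_
    have hd := dist_setCoord (corner g) j (corner g j) (sideWeight (!g j) (1 / 4))
    rw [setCoord_self] at hd
    rw [hs, hd, corner_apply]
    cases g j <;> simp [endpoint, sideWeight]
  have dya : realDist y (X.vertex a) ≤ 3 / 4 := by
    refine (h'.realDist_le hsm (corner_mem (flipAt g j)) rfl
      (by rw [← hj]; exact h'.vertex_eq _)).trans_eq ?_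
    rw [hs, ← setCoord_corner, dist_setCoord]
    cases g j <;> simp [endpoint, sideWeight] <;> norm_num
  have dva : realDist (X.vertex (φ f)) (X.vertex a) = 1 := by
    apply le_antisymm
    · linarith [IsCAT0Space.realDist_triangle hX (X.vertex (φ f)) y (X.vertex a)]
    · exact one_le_realDist_vertex hX ha.1
  have tri := IsCAT0Space.realDist_triangle hX (X.vertex (φ f)) y (X.vertex a)
  have dvy' : realDist (X.vertex (φ f)) y = 1 / 4 := by linarith
  have key := IsCAT0Space.realDist_sq_le hX (p := X.vertex (φ f)) (q := X.vertex x)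
    (r := X.vertex a) (x := q) (y := y) (by change 0 < D; linarith) (by rw [dva]; norm_num) hq2
    (by linarith)
  rw [hq1, dvy', dva, realDist_comm (X.vertex x)] at key
  change _ ≤ _ - _ * ((D ^ 2 + 1 ^ 2 - X.vertexHeight x a ^ 2) / (D * 1)) at key
  -- The comparison angle at `v` is acute because `a` is closer to `x` than `v`. So `q` and `y`,
  -- both at distance `1 / 4` from `v`, have squared distance below `1 / 16 + 1 / 16`.
  have hpos : 0 < (D ^ 2 + 1 ^ 2 - X.vertexHeight x a ^ 2) / (D * 1) := by
    refine div_pos ?_ (by linarith)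
    have : X.vertexHeight x a ^ 2 ≤ D ^ 2 := pow_le_pow_left₀ (realDist_nonneg _ _) hlt.le 2
    linarith
  have hlt8 : realDist q y ^ 2 < 1 / 8 := by nlinarith
  have yv : cubePoint ψ s (ψ g) ≠ 0 := by
    rw [cubePoint_apply h'.injective]
    refine (Finset.prod_pos fun c _ => ?_).ne'
    by_cases hc : c = j
    · subst hc; rw [hs, setCoord_same]; cases g c <;> simp [sideWeight] <;> norm_num
    · rw [hs, setCoord_of_ne _ hc, corner_apply, sideWeight_endpoint]; simp
  have ya : starCoord (φ f) y.1 a = 1 / 4 := by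
    rw [← hg, ← hj]
    change starCoord _ (cubePoint ψ s) _ = _
    rw [h'.starCoord_flipAt yv, hs, setCoord_same]
    cases g j <;> simp [sideWeight]
  have yb : ∀ b, X.graph.Adj (φ f) b → b ≠ a → starCoord (φ f) y.1 b = 0 := by
    intro b hb hba
    change starCoord _ (cubePoint ψ s) _ = _
    by_cases hbr : b ∈ Set.range ψ
    · rw [← hg] at hb ⊢
      obtain ⟨c, rfl⟩ := h'.exists_flipAt_of_adj hb hbr
      have hc : c ≠ j := by rintro rfl; exact hba hj
      rw [h'.starCoord_flipAt yv, hs, setCoord_of_ne _ hc, corner_apply, sideWeight_endpoint]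
      simp
    · exact starCoord_eq_zero (cubePoint_apply_of_notMem hbr s)
  -- In star coordinates `y` is `1 / 4` along `a`, while `q` has no `a`-coordinate and norm at least
  -- `1 / 4`, so the vectors are orthogonal. A path that leaves the star has length at least `3 /
  -- 4`.
  have lower : Real.sqrt (1 / 8) ≤ realDist y q := by
    refine le_realDist hX fun ℓ hℓ => ?_
    set B := Finset.univ.image fun i => φ (flipAt f i) with hB
    have haB : a ∉ B := by
      intro hh
      obtain ⟨i, -, rfl⟩ := Finset.mem_image.1 hh
      exact har (Set.mem_range_self _)
    have hBadj : ∀ b ∈ B, X.graph.Adj (φ f) b := by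
      intro b hb
      obtain ⟨i, -, rfl⟩ := Finset.mem_image.1 hb
      exact h.adj_flipAt f i
    have hA : ∀ b ∈ insert a B, X.graph.Adj (φ f) b := by
      intro b hb
      rcases Finset.mem_insert.1 hb with rfl | hb
      · exact ha
      · exact hBadj b hb
    rw [Real.sqrt_le_left hℓ.nonneg]
    rcases hℓ.starVec (v := φ f) (by rw [← hg]; exact yv) hA with ⟨-, hd⟩ | ⟨b, hb, hle⟩
    · refine le_trans ?_ (pow_le_pow_left₀ dist_nonneg hd 2)
      rw [dist_starVec_sq, Finset.sum_insert haB, ya, hqt, hqa,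
        Finset.sum_congr rfl (g := fun b => starCoord (φ f) (cubePoint φ t) b ^ 2) (fun b hb => by
          rw [yb b (hBadj b hb) (ne_of_mem_of_not_mem hb haB)]; ring),
        hB, Finset.sum_image fun i _ j _ e => flipAt_injective f (h.injective e)]
      have hsum : ∑ i, starCoord (φ f) (cubePoint φ t) (φ (flipAt f i)) ^ 2 =
          dist (corner f) t ^ 2 := by
        rw [dist_sq_eq_sum]
        refine Finset.sum_congr rfl fun i _ => ?_
        rw [h.starCoord_flipAt hqv, corner_apply, ← sq_sub_endpoint]; ring
      rw [hsum]
      have := h.realDist_le (corner_mem f) ht (p := X.vertex (φ f)) (q := q) (h.vertex_eq f) hqt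
      rw [hq1] at this
      have := pow_le_pow_left₀ (by norm_num) this 2
      linarith
    · have : starCoord (φ f) y.1 b ≤ 1 / 4 := by
        by_cases hba : b = a
        · rw [hba, ya]
        · rw [yb b hb hba]; norm_num
      nlinarith
  rw [realDist_comm, Real.sqrt_le_left (realDist_nonneg _ _)] at lower
  linarith

end CubeComplex

/-! ### The graph of a `CAT(0)` cube complex -/

namespace CubeComplex

variable {V : Type*} {X : CubeComplex V}

theorem flipAt_comm {n : ℕ} (f : Fin n → Bool) {i j : Fin n} (hij : i ≠ j) :
    flipAt (flipAt f i) j = flipAt (flipAt f j) i := by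
  ext k
  by_cases hi : k = i
  · subst hi; rw [flipAt_of_ne _ hij, flipAt_same, flipAt_same, flipAt_of_ne _ hij]
  · by_cases hj : k = j
    · subst hj; rw [flipAt_same, flipAt_of_ne _ hi, flipAt_of_ne _ hi, flipAt_same]
    · rw [flipAt_of_ne _ hj, flipAt_of_ne _ hi, flipAt_of_ne _ hi, flipAt_of_ne _ hj]

variable (X) in
/-- `v`, `a`, `u`, `b` are the consecutive vertices of a square of `X`. -/
def IsSquare (v a b u : V) : Prop :=
  ∃ (n : ℕ) (φ : (Fin n → Bool) → V) (f : Fin n → Bool) (i j : Fin n), X.IsChart φ ∧ i ≠ j ∧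
    v = φ f ∧ a = φ (flipAt f i) ∧ b = φ (flipAt f j) ∧ u = φ (flipAt (flipAt f i) j)

namespace IsSquare

variable {v a b u : V}

theorem symm (h : X.IsSquare v a b u) : X.IsSquare v b a u := by
  obtain ⟨n, φ, f, i, j, hφ, hij, rfl, rfl, rfl, rfl⟩ := h
  exact ⟨n, φ, f, j, i, hφ, hij.symm, rfl, rfl, rfl, by rw [flipAt_comm f hij]⟩

theorem rotate (h : X.IsSquare v a b u) : X.IsSquare a v u b := by
  obtain ⟨n, φ, f, i, j, hφ, hij, rfl, rfl, rfl, rfl⟩ := h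
  exact ⟨n, φ, flipAt f i, i, j, hφ, hij, rfl, by rw [flipAt_flipAt], rfl,
    by rw [flipAt_flipAt]⟩

theorem adj (h : X.IsSquare v a b u) : X.graph.Adj v a := by
  obtain ⟨n, φ, f, i, j, hφ, hij, rfl, rfl, rfl, rfl⟩ := h
  exact hφ.adj_flipAt f i

theorem adj_opposite (h : X.IsSquare v a b u) : X.graph.Adj b u := h.symm.rotate.symm.adj

theorem opposite (h : X.IsSquare v a b u) : X.Opposite s(v, a) s(b, u) := by
  refine ⟨v, a, b, u, rfl, rfl, h.adj, h.adj_opposite, ?_⟩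
  obtain ⟨n, φ, f, i, j, hφ, hij, rfl, rfl, rfl, rfl⟩ := h
  exact hφ.square_mem f hij

end IsSquare

/-- The dimension of the cube need not be computed: four distinct vertices `f`, flipped in `i`, in
`j`, or in both, already exhaust the four-element set. -/
theorem Opposite.exists_isSquare {e f : Sym2 V} (h : X.Opposite e f) :
    ∃ v a b u, X.IsSquare v a b u ∧ e = s(v, a) ∧ f = s(b, u) := by
  obtain ⟨x, y, x', y', rfl, rfl, hxy, hxy', hmem, hcard⟩ := h
  obtain ⟨n, φ, hφ, hr⟩ := exists_isChart hmem
  obtain ⟨f, rfl⟩ : x ∈ Set.range φ := hr ▸ by simp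
  obtain ⟨i, rfl⟩ := hφ.exists_flipAt_of_adj hxy (hr ▸ by simp)
  have h4 : ∀ c d e g : V, ({c, d, e, g} : Set V).ncard = 4 → d ≠ c ∧ d ≠ e := by
    classical
    intro c d e g hc
    have h3 : ∀ p q r : V, ({p, q, r} : Set V).ncard ≤ 3 := fun p q r => by
      have := Set.ncard_coe_finset ({p, q, r} : Finset V)
      push_cast at this
      rw [this]
      exact Finset.card_le_three
    constructor
    · rintro rfl
      have := h3 d e g
      rw [Set.insert_eq_of_mem (Set.mem_insert _ _)] at hc
      omega
    · rintro rfl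
      have := h3 c d g
      rw [Set.insert_eq_of_mem (s := {d, g}) (Set.mem_insert _ _)] at hc
      omega
  obtain ⟨hx1, hx2⟩ := h4 _ _ _ _ hcard
  obtain ⟨g, rfl⟩ : x' ∈ Set.range φ := hr ▸ by simp
  -- A vertex that differs from `f` at most in the coordinate `i` would be `x` or `y`, but the four
  -- vertices are distinct.
  obtain ⟨j, hij, hj⟩ : ∃ j, i ≠ j ∧ g j ≠ f j := by
    by_contra hcon
    push Not at hcon
    by_cases hi : g i = f i
    · refine hx1 (congrArg φ (funext fun k => ?_))
      by_cases hk : i = k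
      · rw [← hk, hi]
      · exact hcon k hk
    · refine hx2 (congrArg φ (funext fun k => ?_))
      by_cases hk : i = k
      · rw [← hk, flipAt_same, Bool.eq_not_of_ne hi]
      · rw [flipAt_of_ne f (Ne.symm hk)]; exact hcon k hk
  have inj := hφ.injective
  have e1 : flipAt f j ≠ f := flipAt_ne f j
  have e2 : flipAt f j ≠ flipAt f i := fun e => hij (flipAt_injective f e).symm
  have e3 : flipAt (flipAt f i) j ≠ f := fun e => by
    have := congrFun e i
    rw [flipAt_of_ne _ hij, flipAt_same] at this
    simp at this
  have e4 : flipAt (flipAt f i) j ≠ flipAt f i := flipAt_ne _ j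
  have e5 : flipAt f j ≠ flipAt (flipAt f i) j := fun e => by
    have := congrFun e i
    rw [flipAt_of_ne _ hij, flipAt_of_ne _ hij, flipAt_same] at this
    simp at this
  have m1 : φ (flipAt f j) = φ g ∨ φ (flipAt f j) = y' := by
    have : φ (flipAt f j) ∈ ({φ f, φ g, φ (flipAt f i), y'} : Set V) :=
      hr ▸ Set.mem_range_self _
    rcases this with h | h | h | h
    · exact absurd (inj h) e1
    · exact Or.inl h
    · exact absurd (inj h) e2
    · exact Or.inr h
  have m2 : φ (flipAt (flipAt f i) j) = φ g ∨ φ (flipAt (flipAt f i) j) = y' := by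
    have : φ (flipAt (flipAt f i) j) ∈ ({φ f, φ g, φ (flipAt f i), y'} : Set V) :=
      hr ▸ Set.mem_range_self _
    rcases this with h | h | h | h
    · exact absurd (inj h) e3
    · exact Or.inl h
    · exact absurd (inj h) e4
    · exact Or.inr h
  refine ⟨_, _, _, _, ⟨n, φ, f, i, j, hφ, hij, rfl, rfl, rfl, rfl⟩, rfl, ?_⟩
  rcases m1 with h1 | h1 <;> rcases m2 with h2 | h2
  · exact absurd (inj (h1.trans h2.symm)) e5
  · rw [h1, h2]
  · rw [h1, h2, Sym2.eq_swap]
  · exact absurd (inj (h1.trans h2.symm)) e5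

theorem exists_adj_dist_eq {G : SimpleGraph V} {x v : V} (h : G.Reachable x v) {n : ℕ}
    (hn : G.dist x v = n + 1) : ∃ b, G.Adj v b ∧ G.dist x b = n := by
  obtain ⟨p, hp⟩ := h.symm.exists_walk_length_eq_dist
  rw [SimpleGraph.dist_comm, hn] at hp
  cases p with
  | nil => simp at hp
  | @cons _ b _ hb p =>
    refine ⟨b, hb, ?_⟩
    have h1 : G.dist b x ≤ p.length := SimpleGraph.dist_le p
    have h2 : G.dist v x ≤ G.dist b x + 1 := by
      obtain ⟨q, hq⟩ := p.reachable.exists_walk_length_eq_dist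
      rw [← hq]
      exact SimpleGraph.dist_le (SimpleGraph.Walk.cons hb q)
    rw [SimpleGraph.dist_comm, hn] at h2
    rw [SimpleGraph.Walk.length_cons] at hp
    rw [SimpleGraph.dist_comm]
    omega

theorem dist_le_succ_of_adj (hX : X.IsCAT0) (x : V) {v a : V} (h : X.graph.Adj v a) :
    X.graph.dist x v ≤ X.graph.dist x a + 1 := by
  obtain ⟨p, hp⟩ := (reachable hX x a).exists_walk_length_eq_dist
  rw [← hp]
  exact (SimpleGraph.dist_le (p.concat h.symm)).trans_eq (by simp)

/-- Let `b` be a neighbor of `v` closer to `x` in the graph; by induction it is also lower. If `a ≠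
b`, both lie in a cube with `v`. The fourth vertex of their square is lower than `b`, since parallel
edges are oriented alike, so by induction it is at graph distance `n - 2`, and `a` is at distance `n
- 1`. -/
theorem dist_succ_of_height_lt (hX : X.IsCAT0) (x : V) (n : ℕ) :
    ∀ v, X.graph.dist x v = n → ∀ a, X.graph.Adj v a →
      X.vertexHeight x a < X.vertexHeight x v → X.graph.dist x a + 1 = n := by
  induction n using Nat.strong_induction_on with
  | _ n ih =>
    intro v hv a ha hlt
    have hvx : v ≠ x := by
      rintro rfl
      rw [vertexHeight_self] at hlt
      exact absurd hlt (not_lt.2 (realDist_nonneg _ _))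
    obtain ⟨m, rfl⟩ : ∃ m, n = m + 1 := by
      refine Nat.exists_eq_succ_of_ne_zero ?_
      rintro rfl
      exact hvx ((reachable hX x v).dist_eq_zero_iff.1 hv).symm
    obtain ⟨b, hb, hbm⟩ := exists_adj_dist_eq (reachable hX x v) hv
    have hbv : X.vertexHeight x b < X.vertexHeight x v := by
      rcases (vertexHeight_ne hX x hb).lt_or_gt with h | h
      · have := ih m (Nat.lt_succ_self m) b hbm v hb.symm h
        omega
      · exact h
    by_cases hab : a = b
    · rw [hab, hbm]
    obtain ⟨k, φ, f, hφ, rfl, hd⟩ := exists_chart_of_height_lt hX hvx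
    obtain ⟨i, rfl⟩ := hd a ha hlt
    obtain ⟨j, rfl⟩ := hd b hb hbv
    have hij : i ≠ j := by rintro rfl; exact hab rfl
    have hu : X.vertexHeight x (φ (flipAt (flipAt f j) i)) < X.vertexHeight x (φ (flipAt f j)) :=
      (height_lt_iff_of_isChart hX x hφ (flipAt_of_ne f hij)).2 hlt
    have h1 := ih m (Nat.lt_succ_self m) _ hbm _ (hφ.adj_flipAt _ i) hu
    have h2 := dist_le_succ_of_adj hX x (hφ.adj_flipAt (flipAt f i) j)
    have h3 := dist_le_succ_of_adj hX x ha
    rw [flipAt_comm f hij] at h2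
    omega

theorem height_lt_iff (hX : X.IsCAT0) (x : V) {v a : V} (h : X.graph.Adj v a) :
    X.vertexHeight x a < X.vertexHeight x v ↔ X.graph.dist x a < X.graph.dist x v := by
  constructor
  · intro hlt
    have := dist_succ_of_height_lt hX x _ v rfl a h hlt
    omega
  · intro hlt
    rcases (vertexHeight_ne hX x h).lt_or_gt with h' | h'
    · have := dist_succ_of_height_lt hX x _ a rfl v h.symm h'
      omega
    · exact h'

/-- The graph distance inherits from the height that the ends of an edge are never level. -/
theorem dist_ne (hX : X.IsCAT0) (x : V) {v a : V} (h : X.graph.Adj v a) :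
    X.graph.dist x v ≠ X.graph.dist x a := by
  rcases (vertexHeight_ne hX x h).lt_or_gt with h' | h'
  · exact ((height_lt_iff hX x h.symm).1 h').ne
  · exact ((height_lt_iff hX x h).1 h').ne'

/-- The quadrangle condition: both neighbors are lower, hence in one cube with `v`. It is the source
of all squares below. -/
theorem exists_isSquare_of_dist_lt (hX : X.IsCAT0) {x v a b : V} (ha : X.graph.Adj v a)
    (hb : X.graph.Adj v b) (hab : a ≠ b) (hda : X.graph.dist x a < X.graph.dist x v)
    (hdb : X.graph.dist x b < X.graph.dist x v) : ∃ u, X.IsSquare v a b u := by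
  have hvx : v ≠ x := by rintro rfl; simp at hda
  obtain ⟨k, φ, f, hφ, rfl, hd⟩ := exists_chart_of_height_lt hX hvx
  obtain ⟨i, rfl⟩ := hd a ha ((height_lt_iff hX x ha).2 hda)
  obtain ⟨j, rfl⟩ := hd b hb ((height_lt_iff hX x hb).2 hdb)
  exact ⟨_, k, φ, f, i, j, hφ, by rintro rfl; exact hab rfl, rfl, rfl, rfl, rfl⟩

/-! ### Half-spaces -/

variable (X) in
/-- The vertices that are closer to `x` than to `y`. -/
def halfSpace (x y : V) : Set V := {p | X.graph.dist p x < X.graph.dist p y}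

theorem mem_halfSpace {x y p : V} :
    p ∈ X.halfSpace x y ↔ X.graph.dist p x < X.graph.dist p y := Iff.rfl

theorem IsSquare.halfSpace_eq (hX : X.IsCAT0) {v a b u : V} (h : X.IsSquare v a b u) :
    X.halfSpace a v = X.halfSpace u b := by
  ext p
  change X.graph.dist p a < X.graph.dist p v ↔ X.graph.dist p u < X.graph.dist p b
  rw [← height_lt_iff hX p h.adj, ← height_lt_iff hX p h.adj_opposite]
  obtain ⟨n, φ, f, i, j, hφ, hij, rfl, rfl, rfl, rfl⟩ := h
  rw [flipAt_comm f hij]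
  exact height_lt_iff_of_isChart hX p hφ (flipAt_of_ne f hij).symm

theorem mem_halfSpace_self {x y : V} (hX : X.IsCAT0) (h : X.graph.Adj x y) :
    x ∈ X.halfSpace x y := by
  rw [mem_halfSpace]
  rw [SimpleGraph.dist_self]
  exact Nat.pos_of_ne_zero fun e => h.ne ((reachable hX x y).dist_eq_zero_iff.1 e)

theorem halfSpace_compl (hX : X.IsCAT0) {x y : V} (h : X.graph.Adj x y) (p : V) :
    p ∈ X.halfSpace y x ↔ p ∉ X.halfSpace x y := by
  have := dist_ne hX p h
  rw [mem_halfSpace, mem_halfSpace]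
  omega

theorem hyperplane_comm (x y : V) : X.hyperplane x y = X.hyperplane y x := by
  rw [hyperplane, hyperplane, Sym2.eq_swap]

/-- Passing to the opposite edge of a square preserves the pair of half-spaces; the orientation of
the edge has to be carried along. -/
theorem exists_halfSpace_eq_of_mem_hyperplane (hX : X.IsCAT0) {x y : V} (h : X.graph.Adj x y)
    {f : Sym2 V} (hf : f ∈ X.hyperplane x y) :
    ∃ a b, f = s(a, b) ∧ X.graph.Adj a b ∧ X.halfSpace a b = X.halfSpace x y := by
  have key : ∀ e f, Relation.EqvGen X.Opposite e f →
      ((∃ a b, e = s(a, b) ∧ X.graph.Adj a b ∧ X.halfSpace a b = X.halfSpace x y) ↔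
      ∃ a b, f = s(a, b) ∧ X.graph.Adj a b ∧ X.halfSpace a b = X.halfSpace x y) := by
    intro e f hef
    induction hef with
    | rel e f hef =>
      obtain ⟨v, a, b, u, hs, rfl, rfl⟩ := hef.exists_isSquare
      have one : ∀ {v a b u : V}, X.IsSquare v a b u →
          (∃ c d, s(v, a) = s(c, d) ∧ X.graph.Adj c d ∧ X.halfSpace c d = X.halfSpace x y) →
          ∃ c d, s(b, u) = s(c, d) ∧ X.graph.Adj c d ∧ X.halfSpace c d = X.halfSpace x y := by
        rintro v a b u hs ⟨c, d, hcd, hadj, hh⟩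
        rcases Sym2.eq_iff.1 hcd with ⟨rfl, rfl⟩ | ⟨rfl, rfl⟩
        · exact ⟨b, u, rfl, hs.adj_opposite, (hs.rotate.halfSpace_eq hX).symm.trans hh⟩
        · exact ⟨u, b, Sym2.eq_swap, hs.adj_opposite.symm, (hs.halfSpace_eq hX).symm.trans hh⟩
      exact ⟨one hs, one hs.symm.rotate.symm⟩
    | refl => rfl
    | symm _ _ _ ih => exact ih.symm
    | trans _ _ _ _ _ ih1 ih2 => exact ih1.trans ih2
  exact (key _ _ hf).1 ⟨x, y, rfl, h, rfl⟩

/-- An edge between the half-spaces is pushed towards `{x,y}`. With `q'` the next vertex from `q`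
towards `y`, both `p` and `q'` are closer to `x` than `q`, so there is a square, and its edge
`{p',q'}` opposite to `{p,q}` again joins the half-spaces, one step closer to `x`. -/
theorem mem_hyperplane_of_mem_halfSpace (hX : X.IsCAT0) {x y : V} (h : X.graph.Adj x y)
    {p q : V} (hpq : X.graph.Adj p q) (hp : p ∈ X.halfSpace x y) (hq : q ∉ X.halfSpace x y) :
    s(p, q) ∈ X.hyperplane x y := by
  obtain ⟨n, hn⟩ : ∃ n, X.graph.dist x p = n := ⟨_, rfl⟩
  induction n generalizing p q with
  | zero =>
    obtain rfl := (reachable hX x p).dist_eq_zero_iff.1 hn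
    rw [← halfSpace_compl hX h] at hq
    change X.graph.dist q y < X.graph.dist q x at hq
    have h1 := dist_le_succ_of_adj hX x hpq.symm
    rw [SimpleGraph.dist_self, SimpleGraph.dist_comm] at h1
    obtain rfl := (reachable hX q y).dist_eq_zero_iff.1 (by omega)
    exact Relation.EqvGen.refl _
  | succ n ih =>
    have hq' := (halfSpace_compl hX h q).2 hq
    have hp' := hp
    change X.graph.dist q y < X.graph.dist q x at hq'
    change X.graph.dist p x < X.graph.dist p y at hp'
    rw [SimpleGraph.dist_comm (v := x), SimpleGraph.dist_comm (v := y)] at hp' hq'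
    have i1 := dist_le_succ_of_adj hX x hpq.symm
    have i2 := dist_le_succ_of_adj hX y hpq
    have hqx : X.graph.dist x q = n + 2 := by omega
    have hqy : X.graph.dist y q = n + 1 := by omega
    obtain ⟨q', hqq', hq'y⟩ := exists_adj_dist_eq (reachable hX y q) hqy
    have i3 : X.graph.dist x q' ≤ n + 1 := by
      have := dist_le_succ_of_adj hX q' h
      rw [SimpleGraph.dist_comm, SimpleGraph.dist_comm (u := q')] at this
      omega
    have i4 := dist_le_succ_of_adj hX x hqq'
    have hne : p ≠ q' := by rintro rfl; omega
    obtain ⟨p', hs⟩ := exists_isSquare_of_dist_lt hX (x := x) hpq.symm hqq' hne (by omega)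
      (by omega)
    have hp'q' : q' ∉ X.halfSpace x y := by
      rw [← halfSpace_compl hX h]
      rw [mem_halfSpace]
      rw [SimpleGraph.dist_comm, SimpleGraph.dist_comm (v := x)]
      omega
    have hsym := hs.halfSpace_eq hX
    have hx1 : x ∈ X.halfSpace p q := by
      rw [mem_halfSpace]
      omega
    have hx2 : X.graph.dist x p' < X.graph.dist x q' := by rw [hsym] at hx1; exact hx1
    have i5 := dist_le_succ_of_adj hX x hs.adj_opposite
    have i6 := dist_le_succ_of_adj hX y hs.symm.rotate.symm.rotate.symm.adj.symm
    have i7 := dist_le_succ_of_adj hX y hs.rotate.symm.adj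
    have hpp' : p' ∈ X.halfSpace x y := by
      rw [mem_halfSpace]
      rw [SimpleGraph.dist_comm, SimpleGraph.dist_comm (v := y)]
      omega
    have := ih hs.adj_opposite.symm hpp' hp'q' (by omega)
    refine Relation.EqvGen.trans _ _ _ this (Relation.EqvGen.symm _ _ (Relation.EqvGen.rel _ _ ?_))
    have := hs.opposite
    rwa [Sym2.eq_swap, Sym2.eq_swap (a := q')] at this

theorem halfSpace_eq_of_mem (hX : X.IsCAT0) {x y p q : V} (h : X.graph.Adj x y)
    (hpq : s(p, q) ∈ X.hyperplane x y) (hp : p ∈ X.halfSpace x y) :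
    X.halfSpace p q = X.halfSpace x y := by
  obtain ⟨a, b, hab, hadj, hh⟩ := exists_halfSpace_eq_of_mem_hyperplane hX h hpq
  rcases Sym2.eq_iff.1 hab with ⟨rfl, rfl⟩ | ⟨rfl, rfl⟩
  · exact hh
  · rw [← hh] at hp
    exact absurd hp ((halfSpace_compl hX hadj _).1 (mem_halfSpace_self hX hadj.symm))

theorem mem_hyperplane_iff (hX : X.IsCAT0) {x y p q : V} (h : X.graph.Adj x y) :
    s(p, q) ∈ X.hyperplane x y ↔
      X.graph.Adj p q ∧ (p ∈ X.halfSpace x y ↔ q ∉ X.halfSpace x y) := by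
  constructor
  · intro hpq
    obtain ⟨a, b, hab, hadj, hh⟩ := exists_halfSpace_eq_of_mem_hyperplane hX h hpq
    have h1 := mem_halfSpace_self hX hadj
    have h2 := (halfSpace_compl hX hadj _).1 (mem_halfSpace_self hX hadj.symm)
    rw [hh] at h1 h2
    rcases Sym2.eq_iff.1 hab with ⟨rfl, rfl⟩ | ⟨rfl, rfl⟩
    · exact ⟨hadj, by tauto⟩
    · exact ⟨hadj.symm, by tauto⟩
  · rintro ⟨hadj, hh⟩
    by_cases hp : p ∈ X.halfSpace x y
    · exact mem_hyperplane_of_mem_halfSpace hX h hadj hp (hh.1 hp)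
    · rw [Sym2.eq_swap]
      exact mem_hyperplane_of_mem_halfSpace hX h hadj.symm (by tauto) hp

theorem mem_halfSpace_opposite_iff (hX : X.IsCAT0) {x y p q : V} (h : X.graph.Adj x y)
    (hpq : s(p, q) ∈ X.hyperplane x y) (c : V) :
    c ∈ X.halfSpace q p ↔ (c ∈ X.halfSpace x y ↔ p ∉ X.halfSpace x y) := by
  have hm := (mem_hyperplane_iff hX h).1 hpq
  by_cases hp : p ∈ X.halfSpace x y
  · rw [halfSpace_compl hX hm.1, halfSpace_eq_of_mem hX h hpq hp]
    tauto
  · rw [halfSpace_eq_of_mem hX h (Sym2.eq_swap ▸ hpq) (by tauto)]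
    tauto

/-- A vertex is on at most one edge of a hyperplane. -/
theorem eq_of_mem_hyperplane (hX : X.IsCAT0) {x y v a b : V} (h : X.graph.Adj x y)
    (ha : s(v, a) ∈ X.hyperplane x y) (hb : s(v, b) ∈ X.hyperplane x y) : a = b := by
  -- Both edges separate `v` from the same half-space, so `b` is closer to `a` than to its neighbor
  -- `v`, at distance `0`.
  have h1 := (mem_halfSpace_opposite_iff hX h ha b).2
    ((mem_halfSpace_opposite_iff hX h hb b).1
      (mem_halfSpace_self hX ((mem_hyperplane_iff hX h).1 hb).1.symm))
  rw [mem_halfSpace] at h1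
  have h2 := dist_le_succ_of_adj hX b ((mem_hyperplane_iff hX h).1 hb).1
  rw [SimpleGraph.dist_self] at h2
  exact ((reachable hX b a).dist_eq_zero_iff.1 (by omega)).symm

/-- A path avoiding the hyperplane cannot leave the half-space. Conversely, a geodesic from a vertex
of the half-space to `x` stays in the half-space, so it does not cross. -/
theorem mem_side_iff (hX : X.IsCAT0) {x y : V} (h : X.graph.Adj x y) (p : V) :
    p ∈ X.side (X.hyperplane x y) x ↔ p ∈ X.halfSpace x y := by
  constructor
  · rintro ⟨w⟩
    have key : ∀ {a b : V}, (X.graph.deleteEdges (X.hyperplane x y)).Walk a b →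
        a ∈ X.halfSpace x y → b ∈ X.halfSpace x y := by
      intro a b w
      induction w with
      | nil => exact id
      | @cons a c b hac _ ih =>
        intro ha
        refine ih ?_
        by_contra hc
        rw [SimpleGraph.deleteEdges_adj] at hac
        exact hac.2 (mem_hyperplane_of_mem_halfSpace hX h hac.1 ha hc)
    exact key w (mem_halfSpace_self hX h)
  · intro hp
    obtain ⟨n, hn⟩ : ∃ n, X.graph.dist x p = n := ⟨_, rfl⟩
    induction n generalizing p with
    | zero =>
      obtain rfl := (reachable hX x p).dist_eq_zero_iff.1 hn
      exact SimpleGraph.Reachable.refl _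
    | succ n ih =>
      obtain ⟨q, hpq, hq⟩ := exists_adj_dist_eq (reachable hX x p) hn
      have hp' := hp
      rw [mem_halfSpace] at hp'
      have h1 := dist_le_succ_of_adj hX y hpq
      have hqW : q ∈ X.halfSpace x y := by
        rw [mem_halfSpace]
        rw [SimpleGraph.dist_comm, SimpleGraph.dist_comm (v := y)] at hp' ⊢
        omega
      refine SimpleGraph.Reachable.trans (ih q hqW hq) (SimpleGraph.Adj.reachable ?_)
      rw [SimpleGraph.deleteEdges_adj]
      refine ⟨hpq.symm, fun hmem => ?_⟩
      exact ((mem_hyperplane_iff hX h).1 hmem).2.1 hqW hp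

theorem mem_side_iff' (hX : X.IsCAT0) {x y : V} (h : X.graph.Adj x y) (p : V) :
    p ∈ X.side (X.hyperplane x y) y ↔ p ∉ X.halfSpace x y := by
  rw [hyperplane_comm, mem_side_iff hX h.symm, halfSpace_compl hX h]

/-- If two hyperplanes cross and `p` is adjacent to both, then they cross in a square at `p`. -/
theorem IsSquare.exists_isSquare (hX : X.IsCAT0) {v a b u p p₁ p₂ : V} (h : X.IsSquare v a b u)
    (h1 : s(p, p₁) ∈ X.hyperplane v a) (h2 : s(p, p₂) ∈ X.hyperplane v b) :
    ∃ q, X.IsSquare p p₁ p₂ q := by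
  have k1 := mem_halfSpace_opposite_iff hX h.adj h1
  have k2 := mem_halfSpace_opposite_iff hX h.symm.adj h2
  have m1 := mem_halfSpace_self hX h.adj
  have m2 := (halfSpace_compl hX h.adj a).1 (mem_halfSpace_self hX h.adj.symm)
  have m3 := mem_halfSpace_self hX h.symm.adj
  have m4 := (halfSpace_compl hX h.symm.adj b).1 (mem_halfSpace_self hX h.symm.adj.symm)
  have m5 : b ∈ X.halfSpace v a := by
    rw [h.rotate.halfSpace_eq hX]; exact mem_halfSpace_self hX h.adj_opposite
  have m6 : a ∈ X.halfSpace v b := by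
    rw [h.symm.rotate.halfSpace_eq hX]; exact mem_halfSpace_self hX h.symm.adj_opposite
  have m7 : u ∉ X.halfSpace v a := by
    rw [h.rotate.halfSpace_eq hX, ← halfSpace_compl hX h.adj_opposite]
    exact mem_halfSpace_self hX h.adj_opposite.symm
  have m8 : u ∉ X.halfSpace v b := by
    rw [h.symm.rotate.halfSpace_eq hX, ← halfSpace_compl hX h.symm.adj_opposite]
    exact mem_halfSpace_self hX h.symm.adj_opposite.symm
  have hne : p₁ ≠ p₂ := by
    rintro rfl
    have e1 := (k1 v).symm.trans (k2 v)
    have e2 := (k1 a).symm.trans (k2 a)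
    tauto
  -- The vertices of the given square represent all four quarters, so one of them is across both
  -- hyperplanes from `p`. Seen from it, `p₁` and `p₂` are closer than `p`, and the quadrangle
  -- condition applies.
  have hc : ∃ c, (c ∈ X.halfSpace v a ↔ p ∉ X.halfSpace v a) ∧
      (c ∈ X.halfSpace v b ↔ p ∉ X.halfSpace v b) := by
    by_cases hp1 : p ∈ X.halfSpace v a <;> by_cases hp2 : p ∈ X.halfSpace v b
    · exact ⟨u, by tauto, by tauto⟩
    · exact ⟨a, by tauto, by tauto⟩
    · exact ⟨b, by tauto, by tauto⟩
    · exact ⟨v, by tauto, by tauto⟩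
  obtain ⟨c, hc1, hc2⟩ := hc
  exact exists_isSquare_of_dist_lt hX (x := c) ((mem_hyperplane_iff hX h.adj).1 h1).1
    ((mem_hyperplane_iff hX h.symm.adj).1 h2).1 hne ((k1 c).2 hc1) ((k2 c).2 hc2)

end CubeComplex

/-! ### Operators on `ℓ²` of the vertices -/

section L2

variable {V : Type*}

theorem delta_apply_self (v : V) : (delta v : L2 V) v = 1 := by
  classical exact lp.single_apply_self (E := fun _ : V => ℂ) 2 v 1

theorem delta_apply_of_ne {u v : V} (h : u ≠ v) : (delta v : L2 V) u = 0 := by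
  classical exact lp.single_apply_ne (E := fun _ : V => ℂ) 2 v 1 h

theorem inner_delta (v : V) (ξ : L2 V) : inner ℂ (delta v) ξ = ξ v := by
  classical
  have := lp.inner_single_left (𝕜 := ℂ) (G := fun _ : V => ℂ) v (1 : ℂ) ξ
  rw [delta]
  convert this using 1
  simp

theorem ext_of_delta {F : Type*} [NormedAddCommGroup F] [NormedSpace ℂ F] {A B : L2 V →L[ℂ] F}
    (h : ∀ v, A (delta v) = B (delta v)) : A = B := by
  classical
  refine lp.ext_continuousLinearMap (by norm_num) fun v => ?_
  refine ContinuousLinearMap.ext_ring ?_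
  have := h v
  rw [delta] at this
  simp only [ContinuousLinearMap.comp_apply, lp.singleContinuousLinearMap_apply]
  convert this

theorem permRep_apply {G : Type*} [Group G] [MulAction G V] (g : G) (f : L2 V) (v : V) :
    permRep G g f v = f (g⁻¹ • v) := rfl

theorem permRep_delta {G : Type*} [Group G] [MulAction G V] (g : G) (v : V) :
    permRep G g (delta v) = delta (g • v) := by
  ext u
  rw [permRep_apply]
  by_cases h : u = g • v
  · subst h; rw [inv_smul_smul, delta_apply_self, delta_apply_self]
  · rw [delta_apply_of_ne h, delta_apply_of_ne]
    rintro e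
    exact h (by rw [← e, smul_inv_smul])

open Classical in
/-- The projection onto the functions that vanish off `S`. -/
def projOp (S : Set V) : L2 V →L[ℂ] L2 V :=
  LinearMap.mkContinuous
    { toFun := fun f => ⟨fun v => if v ∈ S then f v else 0, (lp.memℓp f).mono' fun v => by
        split_ifs <;> simp⟩
      map_add' := fun f g => by
        ext v
        change (if v ∈ S then f v + g v else 0) = (if v ∈ S then f v else 0) +
          (if v ∈ S then g v else 0)
        split_ifs <;> simp
      map_smul' := fun c f => by
        ext v
        change (if v ∈ S then c * f v else 0) = c * (if v ∈ S then f v else 0)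
        split_ifs <;> simp }
    1 (fun f => by
      rw [one_mul]
      refine lp.norm_mono (by norm_num) fun v => ?_
      change ‖if v ∈ S then f v else 0‖ ≤ ‖f v‖
      split_ifs <;> simp)

open Classical in
theorem projOp_apply (S : Set V) (f : L2 V) (v : V) :
    projOp S f v = if v ∈ S then f v else 0 := rfl

theorem projOp_delta_of_mem {S : Set V} {v : V} (h : v ∈ S) :
    projOp S (delta v) = delta v := by
  ext u
  rw [projOp_apply]
  by_cases hu : u = v
  · subst hu; rw [if_pos h]
  · rw [delta_apply_of_ne hu, ite_self]

theorem projOp_delta_of_notMem {S : Set V} {v : V} (h : v ∉ S) :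
    projOp S (delta v) = 0 := by
  ext u
  rw [projOp_apply]
  by_cases hu : u = v
  · subst hu; rw [if_neg h]; rfl
  · rw [delta_apply_of_ne hu, ite_self]; rfl

end L2

/-! ### Edge operators -/

namespace CubeComplex

variable {V : Type*} {X : CubeComplex V}

open Classical in
variable (X) in
/-- The sign of the matrix entry `z` of an edge operator. -/
def edgeSign (x y v : V) : ℂ := if v ∈ X.halfSpace x y then -1 else 1

/-- A sign merges the two cases of the definition and replaces the sides by half-spaces. -/
theorem isEdgeOp_iff (hX : X.IsCAT0) {x y : V} (h : X.graph.Adj x y) {z w : ℂ}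
    {T : L2 V →L[ℂ] L2 V} : X.IsEdgeOp z w x y T ↔
      (∀ v u, s(v, u) ∈ X.hyperplane x y →
        T (delta v) = w • delta v + (X.edgeSign x y v * z) • delta u) ∧
      ∀ v, (∀ u, s(v, u) ∉ X.hyperplane x y) → T (delta v) = delta v := by
  constructor
  · intro hT
    refine ⟨fun v u hvu => ?_, hT.other⟩
    by_cases hv : v ∈ X.halfSpace x y
    · rw [hT.pos v u hvu ((mem_side_iff hX h v).2 hv), edgeSign, if_pos hv]
      module
    · rw [hT.neg v u hvu ((mem_side_iff' hX h v).2 hv), edgeSign, if_neg hv]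
      module
  · rintro ⟨h1, h2⟩
    refine ⟨fun v u hvu hv => ?_, fun v u hvu hv => ?_, h2⟩
    · rw [h1 v u hvu, edgeSign, if_pos ((mem_side_iff hX h v).1 hv)]
      module
    · rw [h1 v u hvu, edgeSign, if_neg ((mem_side_iff' hX h v).1 hv)]
      module

open Classical in
variable (X) in
/-- The vertex opposite to `v` across the hyperplane of `{x,y}`, or `v` itself if there is none. -/
def oppositeVertex (x y v : V) : V :=
  if h : ∃ u, s(v, u) ∈ X.hyperplane x y then h.choose else v

theorem oppositeVertex_eq (hX : X.IsCAT0) {x y : V} (h : X.graph.Adj x y) {v u : V}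
    (hvu : s(v, u) ∈ X.hyperplane x y) : X.oppositeVertex x y v = u := by
  have hex : ∃ u, s(v, u) ∈ X.hyperplane x y := ⟨u, hvu⟩
  rw [oppositeVertex, dif_pos hex]
  exact eq_of_mem_hyperplane hX h hex.choose_spec hvu

theorem oppositeVertex_involutive (hX : X.IsCAT0) {x y : V} (h : X.graph.Adj x y) :
    Function.Involutive (X.oppositeVertex x y) := by
  intro v
  by_cases hex : ∃ u, s(v, u) ∈ X.hyperplane x y
  · obtain ⟨u, hu⟩ := hex
    rw [oppositeVertex_eq hX h hu, oppositeVertex_eq hX h (Sym2.eq_swap ▸ hu)]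
  · have : X.oppositeVertex x y v = v := by rw [oppositeVertex, dif_neg hex]
    rw [this, this]

/-- The operator is affine in `z` and `w` with fixed bounded coefficients, built from projections
and the permutation that exchanges the ends of each edge of the hyperplane. This gives boundedness
now and holomorphy later. -/
theorem exists_isEdgeOp (hX : X.IsCAT0) {x y : V} (h : X.graph.Adj x y) :
    ∃ P Q R : L2 V →L[ℂ] L2 V, ∀ z w : ℂ, X.IsEdgeOp z w x y (P + w • Q + z • R) := by
  set N : Set V := {v | ∃ u, s(v, u) ∈ X.hyperplane x y}
  set e : Equiv.Perm V := (oppositeVertex_involutive hX h).toPerm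
  refine ⟨1 - projOp N, projOp N, permRep (Equiv.Perm V) e *
    (projOp (N \ X.halfSpace x y) - projOp (N ∩ X.halfSpace x y)), fun z w => ?_⟩
  rw [isEdgeOp_iff hX h]
  constructor
  · intro v u hvu
    have hN : v ∈ N := ⟨u, hvu⟩
    have he : e • v = u := oppositeVertex_eq hX h hvu
    by_cases hv : v ∈ X.halfSpace x y
    · simp only [add_apply, smul_apply,
        sub_apply, mul_apply_eq_comp,
        one_apply_eq_self, projOp_delta_of_mem hN,
        projOp_delta_of_mem (show v ∈ N ∩ X.halfSpace x y from ⟨hN, hv⟩),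
        projOp_delta_of_notMem (show v ∉ N \ X.halfSpace x y from fun hh => hh.2 hv)]
      rw [zero_sub, map_neg, permRep_delta, he, edgeSign, if_pos hv]
      module
    · simp only [add_apply, smul_apply,
        sub_apply, mul_apply_eq_comp,
        one_apply_eq_self, projOp_delta_of_mem hN,
        projOp_delta_of_notMem (show v ∉ N ∩ X.halfSpace x y from fun hh => hv hh.2),
        projOp_delta_of_mem (show v ∈ N \ X.halfSpace x y from ⟨hN, hv⟩)]
      rw [sub_zero, permRep_delta, he, edgeSign, if_neg hv]
      module
  · intro v hv
    have hN : v ∉ N := fun ⟨u, hu⟩ => hv u hu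
    simp only [add_apply, smul_apply,
      sub_apply, mul_apply_eq_comp,
      one_apply_eq_self, projOp_delta_of_notMem hN,
      projOp_delta_of_notMem (show v ∉ N ∩ X.halfSpace x y from fun hh => hN hh.1),
      projOp_delta_of_notMem (show v ∉ N \ X.halfSpace x y from fun hh => hN hh.1)]
    simp

theorem IsEdgeOp.unique (hX : X.IsCAT0) {x y : V} (h : X.graph.Adj x y) {z w : ℂ}
    {S T : L2 V →L[ℂ] L2 V} (hS : X.IsEdgeOp z w x y S) (hT : X.IsEdgeOp z w x y T) : S = T := by
  rw [isEdgeOp_iff hX h] at hS hT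
  refine ext_of_delta fun v => ?_
  by_cases hex : ∃ u, s(v, u) ∈ X.hyperplane x y
  · obtain ⟨u, hu⟩ := hex
    rw [hS.1 v u hu, hT.1 v u hu]
  · push Not at hex
    rw [hS.2 v hex, hT.2 v hex]

theorem isEdgeOp_edgeOp (hX : X.IsCAT0) {x y : V} (h : X.graph.Adj x y) (z w : ℂ) :
    X.IsEdgeOp z w x y (X.edgeOp z w x y) := by
  obtain ⟨P, Q, R, hP⟩ := exists_isEdgeOp hX h
  have hex : ∃ T, X.IsEdgeOp z w x y T := ⟨_, hP z w⟩
  rw [edgeOp, dif_pos hex]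
  exact hex.choose_spec

theorem edgeSign_mul_self (x y v : V) : X.edgeSign x y v * X.edgeSign x y v = 1 := by
  rw [edgeSign]; split_ifs <;> ring

section edgeOp

variable (hX : X.IsCAT0) {x y : V} (h : X.graph.Adj x y) (z w : ℂ)
include hX h

theorem edgeOp_delta_of_mem {v u : V} (hvu : s(v, u) ∈ X.hyperplane x y) :
    X.edgeOp z w x y (delta v) = w • delta v + (X.edgeSign x y v * z) • delta u :=
  ((isEdgeOp_iff hX h).1 (isEdgeOp_edgeOp hX h z w)).1 v u hvu

theorem edgeOp_delta_of_notMem {v : V} (hv : ∀ u, s(v, u) ∉ X.hyperplane x y) :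
    X.edgeOp z w x y (delta v) = delta v :=
  ((isEdgeOp_iff hX h).1 (isEdgeOp_edgeOp hX h z w)).2 v hv

theorem edgeSign_opposite {v u : V} (hvu : s(v, u) ∈ X.hyperplane x y) :
    X.edgeSign x y u = -X.edgeSign x y v := by
  have := ((mem_hyperplane_iff hX h).1 hvu).2
  rw [edgeSign, edgeSign]
  by_cases hv : v ∈ X.halfSpace x y
  · rw [if_pos hv, if_neg (this.1 hv), neg_neg]
  · rw [if_neg hv, if_pos (by tauto)]

theorem edgeSign_swap (v : V) : X.edgeSign y x v = -X.edgeSign x y v := by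
  rw [edgeSign, edgeSign]
  by_cases hv : v ∈ X.halfSpace x y
  · rw [if_pos hv, if_neg (by rw [halfSpace_compl hX h]; tauto), neg_neg]
  · rw [if_neg hv, if_pos ((halfSpace_compl hX h v).2 hv)]

/-- The rows of the matrix, while the definition gives its columns. The sign changes because the
entry comes from the other end `u`, which has the opposite sign. -/
theorem edgeOp_apply_of_mem {v u : V} (hvu : s(v, u) ∈ X.hyperplane x y) (ξ : L2 V) :
    X.edgeOp z w x y ξ v = w * ξ v - X.edgeSign x y v * z * ξ u := by
  have hne : v ≠ u := ((mem_hyperplane_iff hX h).1 hvu).1.ne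
  have key : innerSL ℂ (delta v) ∘L X.edgeOp z w x y =
      w • innerSL ℂ (delta v) - (X.edgeSign x y v * z) • innerSL ℂ (delta u) := by
    refine ext_of_delta fun p => ?_
    simp only [ContinuousLinearMap.comp_apply, sub_apply,
      smul_apply, innerSL_apply_apply, inner_delta, smul_eq_mul]
    by_cases hex : ∃ q, s(p, q) ∈ X.hyperplane x y
    · obtain ⟨q, hq⟩ := hex
      rw [edgeOp_delta_of_mem hX h z w hq]
      change w * (delta p : L2 V) v + X.edgeSign x y p * z * (delta q : L2 V) v = _
      by_cases hpv : p = v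
      · subst hpv
        obtain rfl := eq_of_mem_hyperplane hX h hvu hq
        rw [delta_apply_of_ne hne, delta_apply_of_ne hne.symm]
        ring
      · by_cases hpu : p = u
        · subst hpu
          obtain rfl := eq_of_mem_hyperplane hX h (Sym2.eq_swap ▸ hvu) hq
          rw [delta_apply_of_ne hne, delta_apply_self, delta_apply_self,
            edgeSign_opposite hX h hvu]
          ring
        · have hqv : v ≠ q := by
            rintro rfl
            exact hpu (eq_of_mem_hyperplane hX h (Sym2.eq_swap ▸ hq) hvu)
          rw [delta_apply_of_ne (Ne.symm hpv), delta_apply_of_ne hqv,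
            delta_apply_of_ne (Ne.symm hpu)]
          ring
    · push Not at hex
      have h1 : v ≠ p := by rintro rfl; exact hex _ hvu
      have h2 : u ≠ p := by rintro rfl; exact hex v (Sym2.eq_swap ▸ hvu)
      rw [edgeOp_delta_of_notMem hX h z w hex, delta_apply_of_ne h1, delta_apply_of_ne h2]
      ring
  have := DFunLike.congr_fun key ξ
  simpa only [ContinuousLinearMap.comp_apply, sub_apply,
    smul_apply, innerSL_apply_apply, inner_delta, smul_eq_mul] using this

theorem edgeOp_apply_of_notMem {v : V} (hv : ∀ u, s(v, u) ∉ X.hyperplane x y) (ξ : L2 V) :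
    X.edgeOp z w x y ξ v = ξ v := by
  have key : innerSL ℂ (delta v) ∘L X.edgeOp z w x y = innerSL ℂ (delta v) := by
    refine ext_of_delta fun p => ?_
    simp only [ContinuousLinearMap.comp_apply, innerSL_apply_apply, inner_delta]
    by_cases hex : ∃ q, s(p, q) ∈ X.hyperplane x y
    · obtain ⟨q, hq⟩ := hex
      rw [edgeOp_delta_of_mem hX h z w hq]
      change w * (delta p : L2 V) v + X.edgeSign x y p * z * (delta q : L2 V) v = _
      have h1 : v ≠ p := by rintro rfl; exact hv _ hq
      have h2 : v ≠ q := by rintro rfl; exact hv p (Sym2.eq_swap ▸ hq)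
      rw [delta_apply_of_ne h1, delta_apply_of_ne h2]
      ring
    · push Not at hex
      rw [edgeOp_delta_of_notMem hX h z w hex]
  have := DFunLike.congr_fun key ξ
  simpa only [ContinuousLinearMap.comp_apply, innerSL_apply_apply, inner_delta] using this

/-- Swapping `x` and `y` replaces `z` by `-z` in each block, and the blocks have determinant `z ^ 2
+ w ^ 2 = 1`. -/
theorem edgeOp_mul_swap (hzw : z ^ 2 + w ^ 2 = 1) :
    X.edgeOp z w x y * X.edgeOp z w y x = 1 := by
  refine ext_of_delta fun v => ?_
  rw [mul_apply_eq_comp, one_apply_eq_self]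
  by_cases hex : ∃ u, s(v, u) ∈ X.hyperplane x y
  · obtain ⟨u, hu⟩ := hex
    rw [edgeOp_delta_of_mem hX h.symm z w (hyperplane_comm x y ▸ hu), map_add, map_smul, map_smul,
      edgeOp_delta_of_mem hX h z w hu, edgeOp_delta_of_mem hX h z w (Sym2.eq_swap ▸ hu),
      edgeSign_swap hX h, edgeSign_opposite hX h hu]
    have e := X.edgeSign_mul_self x y v
    set σ := X.edgeSign x y v
    have : w * w + (-σ * z) * (-σ * z) = 1 := by linear_combination hzw + z ^ 2 * e
    calc _ = (w * w + (-σ * z) * (-σ * z)) • (delta v : L2 V) := by module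
      _ = _ := by rw [this, one_smul]
  · push Not at hex
    rw [edgeOp_delta_of_notMem hX h.symm z w (hyperplane_comm x y ▸ hex),
      edgeOp_delta_of_notMem hX h z w hex]

/-- The blocks are real, with antisymmetric off-diagonal part, so transposition changes `z` into
`-z`. -/
theorem adjoint_edgeOp (hz : star z = z) (hw : star w = w) :
    star (X.edgeOp z w x y) = X.edgeOp z w y x := by
  refine ext_of_delta fun v => ?_
  ext u
  rw [← inner_delta, ContinuousLinearMap.star_eq_adjoint, ContinuousLinearMap.adjoint_inner_right,
    ← inner_conj_symm, inner_delta]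
  change star _ = _
  by_cases hex : ∃ p, s(v, p) ∈ X.hyperplane x y
  · obtain ⟨p, hp⟩ := hex
    have hne : v ≠ p := ((mem_hyperplane_iff hX h).1 hp).1.ne
    rw [edgeOp_apply_of_mem hX h z w hp,
      edgeOp_delta_of_mem hX h.symm z w (hyperplane_comm x y ▸ hp), edgeSign_swap hX h]
    change _ = w * (delta v : L2 V) u + -X.edgeSign x y v * z * (delta p : L2 V) u
    have hs : star (X.edgeSign x y v) = X.edgeSign x y v := by
      rw [edgeSign]; split_ifs <;> simp
    have hd : ∀ a b : V, star ((delta a : L2 V) b) = (delta b : L2 V) a := by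
      intro a b
      by_cases hab : a = b
      · subst hab; rw [delta_apply_self, star_one]
      · rw [delta_apply_of_ne hab, delta_apply_of_ne (Ne.symm hab), star_zero]
    simp only [star_sub, star_mul', hz, hw, hs, hd]
    ring
  · push Not at hex
    rw [edgeOp_apply_of_notMem hX h z w hex,
      edgeOp_delta_of_notMem hX h.symm z w (hyperplane_comm x y ▸ hex)]
    by_cases hab : u = v
    · subst hab; rw [delta_apply_self, star_one]
    · rw [delta_apply_of_ne hab, delta_apply_of_ne (Ne.symm hab), star_zero]

end edgeOp

/-! ### Edge operators of the sides of a square -/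

theorem hyperplane_eq_of_mem {x y a b : V} (h : s(a, b) ∈ X.hyperplane x y) :
    X.hyperplane a b = X.hyperplane x y := by
  ext f
  exact ⟨fun hf => Relation.EqvGen.trans _ _ _ h hf,
    fun hf => Relation.EqvGen.trans _ _ _ (Relation.EqvGen.symm _ _ h) hf⟩

theorem IsSquare.hyperplane_eq {v a b u : V} (h : X.IsSquare v a b u) :
    X.hyperplane b u = X.hyperplane v a :=
  hyperplane_eq_of_mem (Relation.EqvGen.rel _ _ h.opposite)

/-- Opposite edges have the same hyperplane and, oriented alike, the same half-spaces; nothing else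
enters the defining formula. -/
theorem IsSquare.edgeOp_eq (hX : X.IsCAT0) {v a b u : V} (h : X.IsSquare v a b u) (z w : ℂ) :
    X.edgeOp z w b u = X.edgeOp z w v a := by
  have h1 := (isEdgeOp_iff hX h.adj_opposite).1 (isEdgeOp_edgeOp hX h.adj_opposite z w)
  refine IsEdgeOp.unique hX h.adj ((isEdgeOp_iff hX h.adj).2 ?_) (isEdgeOp_edgeOp hX h.adj z w)
  have hs : ∀ p, X.edgeSign b u p = X.edgeSign v a p := by
    intro p
    rw [edgeSign, edgeSign, h.rotate.halfSpace_eq hX]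
  simpa only [h.hyperplane_eq, hs] using h1

theorem IsSquare.ne {v a b u : V} (h : X.IsSquare v a b u) : a ≠ b := by
  obtain ⟨n, φ, f, i, j, hφ, hij, rfl, rfl, rfl, rfl⟩ := h
  exact fun e => hij (flipAt_injective f (hφ.injective e))

/-- An edge of another hyperplane does not change the side. -/
theorem IsSquare.edgeSign_eq (hX : X.IsCAT0) {x y p p₁ p₂ q : V} (h : X.graph.Adj x y)
    (hs : X.IsSquare p p₁ p₂ q) (h1 : s(p, p₁) ∈ X.hyperplane x y) :
    X.edgeSign x y p₂ = X.edgeSign x y p := by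
  have : ¬ (p ∈ X.halfSpace x y ↔ p₂ ∉ X.halfSpace x y) := fun hh =>
    hs.ne (eq_of_mem_hyperplane hX h h1 ((mem_hyperplane_iff hX h).2 ⟨hs.symm.adj, hh⟩))
  rw [edgeSign, edgeSign]
  by_cases hp : p ∈ X.halfSpace x y
  · rw [if_pos hp, if_pos (by tauto)]
  · rw [if_neg hp, if_neg (by tauto)]

/-- If `p₁` were on the second hyperplane, the two would cross in a square at `p₁`, and the edge of
this square at `p` would be on the second hyperplane. -/
theorem IsSquare.notMem_of_notMem (hX : X.IsCAT0) {v a b u p p₁ : V} (h : X.IsSquare v a b u)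
    (h1 : s(p, p₁) ∈ X.hyperplane v a) (h2 : ∀ c, s(p, c) ∉ X.hyperplane v b) (c : V) :
    s(p₁, c) ∉ X.hyperplane v b := by
  intro hc
  obtain ⟨q, hq⟩ := h.exists_isSquare hX (Sym2.eq_swap ▸ h1) hc
  refine h2 q ?_
  rw [← hyperplane_eq_of_mem hc]
  exact Relation.EqvGen.rel _ _ hq.symm.opposite

/-- At a vertex on both hyperplanes the operators act on the two factors of a square, and crossing
one hyperplane does not change the sign for the other. At a vertex on only one of them, the other
operator fixes both Dirac functions involved. -/
theorem IsSquare.edgeOp_comm (hX : X.IsCAT0) {v a b u : V} (h : X.IsSquare v a b u) (z w : ℂ) :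
    X.edgeOp z w v a * X.edgeOp z w v b = X.edgeOp z w v b * X.edgeOp z w v a := by
  have one : ∀ {v a b u p : V}, X.IsSquare v a b u → (∃ c, s(p, c) ∈ X.hyperplane v a) →
      (∀ c, s(p, c) ∉ X.hyperplane v b) → X.edgeOp z w v a (X.edgeOp z w v b (delta p)) =
        X.edgeOp z w v b (X.edgeOp z w v a (delta p)) := by
    rintro v a b u p h ⟨c, hc⟩ h2
    have h3 := h.notMem_of_notMem hX hc h2
    rw [edgeOp_delta_of_notMem hX h.symm.adj z w h2, edgeOp_delta_of_mem hX h.adj z w hc,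
      map_add, map_smul, map_smul, edgeOp_delta_of_notMem hX h.symm.adj z w h2,
      edgeOp_delta_of_notMem hX h.symm.adj z w h3]
  refine ext_of_delta fun p => ?_
  rw [mul_apply_eq_comp, mul_apply_eq_comp]
  by_cases h1 : ∃ c, s(p, c) ∈ X.hyperplane v a <;> by_cases h2 : ∃ c, s(p, c) ∈ X.hyperplane v b
  · obtain ⟨p₁, h1⟩ := h1
    obtain ⟨p₂, h2⟩ := h2
    obtain ⟨q, hq⟩ := h.exists_isSquare hX h1 h2
    have h3 : s(p₂, q) ∈ X.hyperplane v a := by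
      rw [← hyperplane_eq_of_mem h1]
      exact Relation.EqvGen.rel _ _ hq.opposite
    have h4 : s(p₁, q) ∈ X.hyperplane v b := by
      rw [← hyperplane_eq_of_mem h2]
      exact Relation.EqvGen.rel _ _ hq.symm.opposite
    rw [edgeOp_delta_of_mem hX h.adj z w h1, edgeOp_delta_of_mem hX h.symm.adj z w h2]
    simp only [map_add, map_smul]
    rw [edgeOp_delta_of_mem hX h.adj z w h1, edgeOp_delta_of_mem hX h.symm.adj z w h2,
      edgeOp_delta_of_mem hX h.adj z w h3, edgeOp_delta_of_mem hX h.symm.adj z w h4,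
      hq.edgeSign_eq hX h.adj h1, hq.symm.edgeSign_eq hX h.symm.adj h2]
    module
  · exact one h h1 (by simpa using h2)
  · exact (one h.symm h2 (by simpa using h1)).symm
  · push Not at h1 h2
    rw [edgeOp_delta_of_notMem hX h.adj z w h1, edgeOp_delta_of_notMem hX h.symm.adj z w h2,
      edgeOp_delta_of_notMem hX h.adj z w h1]

/-! ### Independence of the path -/

section pathOp

variable (hX : X.IsCAT0) {z w : ℂ} (hzw : z ^ 2 + w ^ 2 = 1)
include hX

theorem dist_succ_of_dist_lt (x : V) {v a : V} (h : X.graph.Adj v a)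
    (hlt : X.graph.dist x a < X.graph.dist x v) : X.graph.dist x a + 1 = X.graph.dist x v := by
  have := dist_le_succ_of_adj hX x h
  omega

/-- Geodesics with different first edges to `a` and `b` are compared with geodesics through the
fourth vertex of the square of `v`, `a`, `b`. The products of the first two operators agree as the
operators of a square commute. -/
theorem pathOp_eq_of_length_eq_dist {x : V} (n : ℕ) : ∀ {v : V} (p q : X.graph.Walk v x),
    X.graph.dist x v = n → p.length = n → q.length = n → X.pathOp z w p = X.pathOp z w q := by
  have hlen : ∀ {v a : V} {k : ℕ} (h : X.graph.Adj v a) (p : X.graph.Walk a x),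
      X.graph.dist x v = k + 1 → p.length = k → X.graph.dist x a = k := by
    intro v a k h p hv hp
    have h1 := SimpleGraph.dist_le p
    rw [SimpleGraph.dist_comm] at h1
    have h2 := dist_le_succ_of_adj hX x h
    omega
  induction n with
  | zero =>
    intro v p q _ hp hq
    cases p with
    | nil => cases q with
      | nil => rfl
      | cons _ _ => simp at hq
    | cons _ _ => simp at hp
  | succ n ih =>
    intro v p q hv hp hq
    cases p with
    | nil => simp at hp
    | @cons _ a _ ha p =>
      cases q with
      | nil => simp at hq
      | @cons _ b _ hb q =>
        simp only [SimpleGraph.Walk.length_cons, Nat.add_right_cancel_iff] at hp hq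
        have hda := hlen ha p hv hp
        have hdb := hlen hb q hv hq
        rw [pathOp, pathOp]
        by_cases hab : a = b
        · subst hab
          rw [ih p q hda hp hq]
        · obtain ⟨u, hs⟩ := exists_isSquare_of_dist_lt hX (x := x) ha hb hab (by omega) (by omega)
          have hu : X.graph.dist x u < X.graph.dist x b := by
            have : x ∈ X.halfSpace a v := by rw [mem_halfSpace]; omega
            rwa [hs.halfSpace_eq hX] at this
          have hu' := dist_succ_of_dist_lt hX x hs.adj_opposite hu
          obtain ⟨r, hr⟩ := (reachable hX u x).exists_walk_length_eq_dist
          rw [SimpleGraph.dist_comm] at hr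
          rw [ih p (.cons hs.symm.adj_opposite r) hda hp
              (by rw [SimpleGraph.Walk.length_cons]; omega),
            ih q (.cons hs.adj_opposite r) hdb hq (by rw [SimpleGraph.Walk.length_cons]; omega),
            pathOp, pathOp, ← mul_assoc, ← mul_assoc, hs.edgeOp_eq hX, hs.symm.edgeOp_eq hX,
            hs.edgeOp_comm hX]

include hzw

theorem pathOp_eq {x v : V} (p q : X.graph.Walk v x) : X.pathOp z w p = X.pathOp z w q := by
  have key : ∀ {v x : V} (p q : X.graph.Walk v x), q.length = X.graph.dist x v →
      X.pathOp z w p = X.pathOp z w q := by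
    intro v x p
    induction p with
    | nil =>
      intro q hq
      exact pathOp_eq_of_length_eq_dist hX 0 _ _ (by simp) rfl (by simpa using hq)
    | @cons v a x h p ih =>
      intro q hq
      obtain ⟨r, hr⟩ := (reachable hX a x).exists_walk_length_eq_dist
      rw [SimpleGraph.dist_comm] at hr
      rw [pathOp, ih r hr]
      -- The first edge either leads away from `x`, and then a geodesic from `a` may turn back
      -- through `v` and the two operators cancel, or it extends a geodesic from `a` to one from
      -- `v`.
      rcases (dist_ne hX x h).lt_or_gt with hlt | hlt
      · have := dist_succ_of_dist_lt hX x h.symm hlt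
        rw [pathOp_eq_of_length_eq_dist hX (X.graph.dist x a) r (.cons h.symm q) rfl hr
          (by rw [SimpleGraph.Walk.length_cons]; omega), pathOp, ← mul_assoc,
          edgeOp_mul_swap hX h z w hzw, one_mul]
      · have := dist_succ_of_dist_lt hX x h hlt
        exact pathOp_eq_of_length_eq_dist hX (X.graph.dist x v) (.cons h r) q rfl
          (by rw [SimpleGraph.Walk.length_cons]; omega) hq
  obtain ⟨r, hr⟩ := (reachable hX v x).exists_walk_length_eq_dist
  rw [SimpleGraph.dist_comm] at hr
  rw [key p r hr, key q r hr]

theorem pathOp_eq_cocycle {x y : V} (p : X.graph.Walk x y) :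
    X.pathOp z w p = X.cocycle z w x y := by
  have hne : Nonempty (X.graph.Walk x y) := ⟨p⟩
  rw [cocycle, dif_pos hne]
  exact pathOp_eq hX hzw _ _

theorem cocycle_self (x : V) : X.cocycle z w x x = 1 :=
  (pathOp_eq_cocycle hX hzw SimpleGraph.Walk.nil).symm

theorem edgeOp_mul_cocycle {x v : V} (h : X.graph.Adj x v) (y : V) :
    X.edgeOp z w x v * X.cocycle z w v y = X.cocycle z w x y := by
  obtain ⟨p⟩ := reachable hX v y
  rw [← pathOp_eq_cocycle hX hzw p, ← pathOp_eq_cocycle hX hzw (.cons h p), pathOp]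

theorem cocycle_mul (v x y : V) :
    X.cocycle z w v x * X.cocycle z w x y = X.cocycle z w v y := by
  obtain ⟨p⟩ := reachable hX v x
  induction p with
  | nil => rw [cocycle_self hX hzw, one_mul]
  | cons h p ih =>
    rw [← edgeOp_mul_cocycle hX hzw h, mul_assoc, ih, edgeOp_mul_cocycle hX hzw h]

end pathOp

/-! ### Equivariance -/

section Action

variable {G : Type*} [Group G] [MulAction G V]

theorem adj_smul (hG : ∀ (g : G), ∀ C ∈ X.cubes, (fun v : V => g • v) '' C ∈ X.cubes) (g : G)
    {x y : V} (h : X.graph.Adj x y) : X.graph.Adj (g • x) (g • y) := by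
  refine ⟨fun e => h.1 (MulAction.injective g e), ?_⟩
  have := hG g _ h.2
  rwa [Set.image_pair] at this

theorem dist_smul (hX : X.IsCAT0)
    (hG : ∀ (g : G), ∀ C ∈ X.cubes, (fun v : V => g • v) '' C ∈ X.cubes) (g : G) (x y : V) :
    X.graph.dist (g • x) (g • y) = X.graph.dist x y := by
  have key : ∀ (g : G) (x y : V), X.graph.dist (g • x) (g • y) ≤ X.graph.dist x y := by
    intro g x y
    obtain ⟨p, hp⟩ := (reachable hX x y).exists_walk_length_eq_dist
    let F : X.graph →g X.graph := ⟨fun v => g • v, fun h => adj_smul hG g h⟩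
    rw [← hp, ← SimpleGraph.Walk.length_map F p]
    exact SimpleGraph.dist_le (p.map F)
  refine le_antisymm (key g x y) ?_
  have := key g⁻¹ (g • x) (g • y)
  rwa [inv_smul_smul, inv_smul_smul] at this

theorem smul_mem_halfSpace_iff (hX : X.IsCAT0)
    (hG : ∀ (g : G), ∀ C ∈ X.cubes, (fun v : V => g • v) '' C ∈ X.cubes) (g : G) (x y p : V) :
    g • p ∈ X.halfSpace (g • x) (g • y) ↔ p ∈ X.halfSpace x y := by
  rw [mem_halfSpace, mem_halfSpace, dist_smul hX hG, dist_smul hX hG]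

theorem smul_mem_hyperplane_iff (hX : X.IsCAT0)
    (hG : ∀ (g : G), ∀ C ∈ X.cubes, (fun v : V => g • v) '' C ∈ X.cubes) (g : G) {x y : V}
    (h : X.graph.Adj x y) (p q : V) :
    s(g • p, g • q) ∈ X.hyperplane (g • x) (g • y) ↔ s(p, q) ∈ X.hyperplane x y := by
  rw [mem_hyperplane_iff hX h, mem_hyperplane_iff hX (adj_smul hG g h),
    smul_mem_halfSpace_iff hX hG, smul_mem_halfSpace_iff hX hG]
  refine and_congr_left fun _ => ⟨fun hh => ?_, adj_smul hG g⟩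
  have := adj_smul hG g⁻¹ hh
  rwa [inv_smul_smul, inv_smul_smul] at this

theorem permRep_mul_edgeOp (hX : X.IsCAT0)
    (hG : ∀ (g : G), ∀ C ∈ X.cubes, (fun v : V => g • v) '' C ∈ X.cubes) (g : G) {x y : V}
    (h : X.graph.Adj x y) (z w : ℂ) :
    permRep G g * X.edgeOp z w x y = X.edgeOp z w (g • x) (g • y) * permRep G g := by
  refine ext_of_delta fun p => ?_
  rw [mul_apply_eq_comp, mul_apply_eq_comp, permRep_delta]
  have hg := adj_smul hG g h
  by_cases hex : ∃ q, s(p, q) ∈ X.hyperplane x y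
  · obtain ⟨q, hq⟩ := hex
    have hs : X.edgeSign (g • x) (g • y) (g • p) = X.edgeSign x y p := by
      by_cases hp : p ∈ X.halfSpace x y
      · rw [edgeSign, edgeSign, if_pos hp, if_pos ((smul_mem_halfSpace_iff hX hG g x y p).2 hp)]
      · rw [edgeSign, edgeSign, if_neg hp, if_neg fun hh =>
          hp ((smul_mem_halfSpace_iff hX hG g x y p).1 hh)]
    rw [edgeOp_delta_of_mem hX h z w hq,
      edgeOp_delta_of_mem hX hg z w ((smul_mem_hyperplane_iff hX hG g h p q).2 hq),
      map_add, map_smul, map_smul, permRep_delta, permRep_delta, hs]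
  · push Not at hex
    rw [edgeOp_delta_of_notMem hX h z w hex, edgeOp_delta_of_notMem hX hg z w, permRep_delta]
    intro q hq
    rw [← smul_inv_smul g q, smul_mem_hyperplane_iff hX hG g h] at hq
    exact hex _ hq

theorem permRep_mul_cocycle (hX : X.IsCAT0)
    (hG : ∀ (g : G), ∀ C ∈ X.cubes, (fun v : V => g • v) '' C ∈ X.cubes) {z w : ℂ}
    (hzw : z ^ 2 + w ^ 2 = 1) (g : G) (x y : V) :
    permRep G g * X.cocycle z w x y = X.cocycle z w (g • x) (g • y) * permRep G g := by
  obtain ⟨p⟩ := reachable hX x y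
  induction p with
  | nil => rw [cocycle_self hX hzw, cocycle_self hX hzw, mul_one, one_mul]
  | cons h p ih =>
    rw [← edgeOp_mul_cocycle hX hzw h, ← mul_assoc, permRep_mul_edgeOp hX hG g h, mul_assoc, ih,
      ← mul_assoc, edgeOp_mul_cocycle hX hzw (adj_smul hG g h)]

theorem isCocycle_cocycle (hX : X.IsCAT0)
    (hG : ∀ (g : G), ∀ C ∈ X.cubes, (fun v : V => g • v) '' C ∈ X.cubes) {z w : ℂ}
    (hzw : z ^ 2 + w ^ 2 = 1) : IsCocycle G (X.cocycle z w) where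
  self := cocycle_self hX hzw
  mul := cocycle_mul hX hzw
  equivariant g x y := by
    rw [permRep_mul_cocycle hX hG hzw, mul_assoc, ← map_mul, mul_inv_cancel, map_one, mul_one]

/-- Multiplicativity is the cocycle identity along `x`, `gx`, `ghx` after moving `π(g)` past
`c(x,hx)`. Invertibility is automatic, as the source is a group. -/
theorem exists_monoidHom_eq_cocycleRep {z w : ℂ} (hc : IsCocycle G (X.cocycle z w)) (x : V) :
    ∃ R : G →* (L2 V →L[ℂ] L2 V)ˣ, ∀ g, (R g : L2 V →L[ℂ] L2 V) = X.cocycleRep z w x g := by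
  let R : G →* (L2 V →L[ℂ] L2 V) :=
    { toFun := X.cocycleRep z w x
      map_one' := by rw [cocycleRep, one_smul, hc.self, map_one, one_mul]
      map_mul' := fun g h => by
        simp only [cocycleRep]
        rw [← hc.mul x (g • x) ((g * h) • x), mul_smul, ← hc.equivariant, map_mul]
        simp only [mul_assoc]
        rw [← mul_assoc (permRep G g⁻¹), ← map_mul, inv_mul_cancel, map_one, one_mul] }
  exact ⟨R.toHomUnits, fun g => rfl⟩

theorem star_permRep (g : G) : star (permRep G g : L2 V →L[ℂ] L2 V) = permRep G g⁻¹ := by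
  refine ext_of_delta fun v => ?_
  ext u
  rw [← inner_delta, ContinuousLinearMap.star_eq_adjoint, ContinuousLinearMap.adjoint_inner_right,
    permRep_delta, permRep_delta, inner_delta]
  by_cases h : u = g⁻¹ • v
  · subst h; rw [smul_inv_smul, delta_apply_self, delta_apply_self]
  · rw [delta_apply_of_ne h, delta_apply_of_ne]
    rintro rfl
    exact h (inv_smul_smul g u).symm

theorem permRep_mem_unitary (g : G) : (permRep G g : L2 V →L[ℂ] L2 V) ∈ unitary _ := by
  rw [Unitary.mem_iff, star_permRep, ← map_mul, ← map_mul, inv_mul_cancel, mul_inv_cancel, map_one]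
  exact ⟨rfl, rfl⟩

end Action

/-! ### Unitarity for real parameters -/

theorem edgeOp_mem_unitary (hX : X.IsCAT0) {x y : V} (h : X.graph.Adj x y) {z w : ℂ}
    (hzw : z ^ 2 + w ^ 2 = 1) (hz : star z = z) (hw : star w = w) :
    X.edgeOp z w x y ∈ unitary (L2 V →L[ℂ] L2 V) := by
  rw [Unitary.mem_iff, adjoint_edgeOp hX h z w hz hw]
  exact ⟨edgeOp_mul_swap hX h.symm z w hzw, edgeOp_mul_swap hX h z w hzw⟩

theorem pathOp_mem_unitary (hX : X.IsCAT0) {z w : ℂ} (hzw : z ^ 2 + w ^ 2 = 1)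
    (hz : star z = z) (hw : star w = w) {x y : V} (p : X.graph.Walk x y) :
    X.pathOp z w p ∈ unitary (L2 V →L[ℂ] L2 V) := by
  induction p with
  | nil => rw [pathOp]; exact one_mem _
  | cons h p ih =>
    rw [pathOp]
    exact mul_mem (edgeOp_mem_unitary hX h hzw hz hw) ih

/-! ### Dependence on the parameter -/

theorem differentiableOn_pathOp (hX : X.IsCAT0) {w : ℂ → ℂ} {U : Set ℂ}
    (hw : DifferentiableOn ℂ w U) {x y : V} (p : X.graph.Walk x y) :
    DifferentiableOn ℂ (fun z => X.pathOp z (w z) p) U := by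
  induction p with
  | nil => simp only [pathOp]; exact differentiableOn_const _
  | @cons x v y h p ih =>
    simp only [pathOp]
    refine DifferentiableOn.mul ?_ ih
    obtain ⟨P, Q, R, hP⟩ := exists_isEdgeOp hX h
    have : (fun z => X.edgeOp z (w z) x v) = fun z => P + w z • Q + z • R :=
      funext fun z => IsEdgeOp.unique hX h (isEdgeOp_edgeOp hX h z (w z)) (hP z (w z))
    rw [this]
    exact ((differentiableOn_const P).add (hw.smul_const Q)).add (differentiableOn_id.smul_const R)

/-! ### The matrix coefficient -/

theorem dist_le_add_length (hX : X.IsCAT0) (x : V) {c y : V} (q : X.graph.Walk c y) :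
    X.graph.dist x y ≤ X.graph.dist x c + q.length := by
  induction q with
  | nil => simp
  | cons h q ih =>
    have := dist_le_succ_of_adj hX x h.symm
    rw [SimpleGraph.Walk.length_cons]
    omega

/-- The operator of another hyperplane only mixes the ends of edges that do not join the two
half-spaces of `{x,y}`. -/
theorem edgeOp_apply_eq_zero (hX : X.IsCAT0) {x y a b : V} (h : X.graph.Adj x y)
    (hab : X.graph.Adj a b) (hne : s(a, b) ∉ X.hyperplane x y) (z w : ℂ) {ξ : L2 V}
    (hξ : ∀ q ∈ X.halfSpace x y, ξ q = 0) :
    ∀ q ∈ X.halfSpace x y, X.edgeOp z w a b ξ q = 0 := by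
  intro q hq
  by_cases hex : ∃ r, s(q, r) ∈ X.hyperplane a b
  · obtain ⟨r, hr⟩ := hex
    have hqr := ((mem_hyperplane_iff hX hab).1 hr).1
    have hr' : r ∈ X.halfSpace x y := by
      by_contra hr'
      have h1 := mem_hyperplane_of_mem_halfSpace hX h hqr hq hr'
      refine hne ?_
      rw [← hyperplane_eq_of_mem h1, hyperplane_eq_of_mem hr]
      exact Relation.EqvGen.refl _
    rw [edgeOp_apply_of_mem hX hab z w hr, hξ q hq, hξ r hr']
    ring
  · push Not at hex
    rw [edgeOp_apply_of_notMem hX hab z w hex, hξ q hq]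

/-- The operator of a geodesic that does not cross a hyperplane preserves the functions that
vanish on one side of it. -/
theorem pathOp_apply_eq_zero (hX : X.IsCAT0) {x v y : V} (h : X.graph.Adj x v)
    (hy : X.graph.dist x y = X.graph.dist v y + 1) (z w : ℂ) {c : V} (q : X.graph.Walk c y)
    (hq : X.graph.dist v c + q.length ≤ X.graph.dist v y) {ξ : L2 V}
    (hξ : ∀ r ∈ X.halfSpace x v, ξ r = 0) : ∀ r ∈ X.halfSpace x v, X.pathOp z w q ξ r = 0 := by
  induction q with
  | nil => rw [pathOp]; exact hξ
  | @cons c d y hcd q ih =>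
    -- All vertices of the path are closer to `v` than to `x`: the rest of the path completes a
    -- geodesic from `v`, while `y` is one step further from `x`.
    have mem : ∀ {e : V} (q' : X.graph.Walk e y),
        X.graph.dist v e + q'.length ≤ X.graph.dist v y → e ∉ X.halfSpace x v := by
      intro e q' hq'
      have := dist_le_add_length hX x q'
      rw [mem_halfSpace, SimpleGraph.dist_comm, SimpleGraph.dist_comm (u := e)]
      omega
    have hd : X.graph.dist v d + q.length ≤ X.graph.dist v y := by
      have := dist_le_succ_of_adj hX v hcd.symm
      rw [SimpleGraph.Walk.length_cons] at hq
      omega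
    rw [pathOp]
    refine edgeOp_apply_eq_zero hX h hcd (fun hmem => ?_) z w (ih hy hd)
    have := ((mem_hyperplane_iff hX h).1 hmem).2
    exact mem _ hq (this.2 (mem _ hd))

/-- The operator of the rest of the geodesic sends `delta y` to a function that still vanishes at
`x`. So the first edge operator, evaluated at `x`, returns `z` times the value at `v`, and `w` plays
no role. -/
theorem pathOp_delta_apply (hX : X.IsCAT0) (z w : ℂ) {x y : V} (p : X.graph.Walk x y)
    (hp : p.length = X.graph.dist x y) :
    X.pathOp z w p (delta y) x = z ^ p.length := by
  induction p with
  | nil => rw [pathOp]; exact (delta_apply_self _).trans (by simp)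
  | @cons x v y h p ih =>
    rw [SimpleGraph.Walk.length_cons] at hp
    have h1 := dist_le_add_length hX x p
    have h2 := SimpleGraph.dist_le p
    have h3 : X.graph.dist x y ≤ X.graph.dist v y + 1 := by
      have := dist_le_succ_of_adj hX y h
      rwa [SimpleGraph.dist_comm, SimpleGraph.dist_comm (v := v)] at this
    have hx := mem_halfSpace_self hX h
    have hy : ∀ r ∈ X.halfSpace x v, (delta y : L2 V) r = 0 := by
      intro r hr
      refine delta_apply_of_ne ?_
      rintro rfl
      rw [mem_halfSpace, SimpleGraph.dist_comm, SimpleGraph.dist_comm (v := v)] at hr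
      omega
    have h4 := pathOp_apply_eq_zero hX h (by omega) z w p
      (by rw [SimpleGraph.dist_self]; omega) hy x hx
    rw [pathOp, mul_apply_eq_comp,
      edgeOp_apply_of_mem hX h z w (u := v) (Relation.EqvGen.refl _), h4, ih (by omega), edgeSign,
      if_pos hx, SimpleGraph.Walk.length_cons, pow_succ]
    ring

end CubeComplex

/-! ### The main theorem -/

theorem star_eq_self_of_sq_eq {w : ℂ} {r : ℝ} (hr : 0 ≤ r) (h : w ^ 2 = (r : ℂ)) :
    star w = w := by
  have h1 : (w - Real.sqrt r) * (w + Real.sqrt r) = 0 := by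
    have : ((Real.sqrt r : ℝ) : ℂ) ^ 2 = (r : ℂ) := by
      rw [← Complex.ofReal_pow, Real.sq_sqrt hr]
    linear_combination h - this
  rcases mul_eq_zero.1 h1 with h2 | h2
  · rw [sub_eq_zero.1 h2]; exact Complex.conj_ofReal _
  · rw [eq_neg_of_add_eq_zero_left h2, star_neg]
    congr 1
    exact Complex.conj_ofReal _

theorem mainTheorem7 {V : Type*} (X : CubeComplex V) (hX : X.IsCAT0)
    {G : Type*} [Group G] [MulAction G V]
    (hG : ∀ (g : G), ∀ C ∈ X.cubes, (fun v : V => g • v) '' C ∈ X.cubes)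
    (w : ℂ → ℂ) (hw : DifferentiableOn ℂ w (Metric.ball (0 : ℂ) 1))
    (hzw : ∀ z ∈ Metric.ball (0 : ℂ) 1, z ^ 2 + w z ^ 2 = 1) :
    -- the operators of edges are well defined by their formula
    (∀ z ∈ Metric.ball (0 : ℂ) 1, ∀ x y : V, X.graph.Adj x y →
      X.IsEdgeOp z (w z) x y (X.edgeOp z (w z) x y) ∧
      ∀ T, X.IsEdgeOp z (w z) x y T → T = X.edgeOp z (w z) x y) ∧
    -- any two vertices are joined by an edge-path, and the product does not depend on the path
    (∀ x y : V, Nonempty (X.graph.Walk x y)) ∧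
    (∀ z ∈ Metric.ball (0 : ℂ) 1, ∀ (x y : V) (p : X.graph.Walk x y),
      X.pathOp z (w z) p = X.cocycle z (w z) x y) ∧
    -- the product is a cocycle for the permutation representation
    (∀ z ∈ Metric.ball (0 : ℂ) 1, IsCocycle G (X.cocycle z (w z))) ∧
    -- the representations form a holomorphic family, unitary for real parameters
    (∀ x : V, IsHolomorphicFamily (fun z (g : G) => X.cocycleRep z (w z) x g)) ∧
    (∀ t : ℝ, |t| < 1 → ∀ (x : V) (g : G),
      X.cocycleRep (t : ℂ) (w t) x g ∈ unitary (L2 V →L[ℂ] L2 V)) ∧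
    -- the matrix coefficient
    (∀ z ∈ Metric.ball (0 : ℂ) 1, ∀ (x : V) (g : G),
      inner ℂ (delta x) (X.cocycleRep z (w z) x g (delta x)) =
        z ^ X.graph.dist x (g • x)) := by
  have hc : ∀ z ∈ Metric.ball (0 : ℂ) 1, IsCocycle G (X.cocycle z (w z)) := fun z hz =>
    X.isCocycle_cocycle hX hG (hzw z hz)
  refine ⟨fun z hz x y h => ⟨X.isEdgeOp_edgeOp hX h z (w z), fun T hT =>
    CubeComplex.IsEdgeOp.unique hX h hT (X.isEdgeOp_edgeOp hX h z (w z))⟩,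
    fun x y => X.reachable hX x y,
    fun z hz x y p => X.pathOp_eq_cocycle hX (hzw z hz) p, hc, fun x => ⟨fun z hz =>
      X.exists_monoidHom_eq_cocycleRep (hc z hz) x, fun g ξ ξ' => ?_⟩, fun t ht x g => ?_,
    fun z hz x g => ?_⟩
  -- One path serves all `z`; the path chosen in `cocycle` need not be known.
  · obtain ⟨p⟩ := X.reachable hX x (g • x)
    have h1 := X.differentiableOn_pathOp hX hw p
    have h2 : DifferentiableOn ℂ (fun z => innerSL ℂ ξ' (X.pathOp z (w z) p (permRep G g ξ)))
        (Metric.ball (0 : ℂ) 1) :=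
      (innerSL ℂ ξ').differentiable.comp_differentiableOn
        (h1.clm_apply (differentiableOn_const _))
    refine h2.congr fun z hz => ?_
    rw [X.pathOp_eq_cocycle hX (hzw z hz) p]
    rfl
  · have htb : (t : ℂ) ∈ Metric.ball (0 : ℂ) 1 := by simpa using ht
    obtain ⟨p⟩ := X.reachable hX x (g • x)
    rw [CubeComplex.cocycleRep, ← X.pathOp_eq_cocycle hX (hzw t htb) p]
    refine mul_mem (X.pathOp_mem_unitary hX (hzw t htb) (Complex.conj_ofReal t) ?_ p)
      (CubeComplex.permRep_mem_unitary g)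
    -- For real `t` in the disk, `w t` is a square root of `1 - t ^ 2 > 0`, hence real for either
    -- choice of the branch.
    refine star_eq_self_of_sq_eq (r := 1 - t ^ 2) ?_ ?_
    · have := (sq_lt_one_iff_abs_lt_one t).2 ht
      linarith
    · push_cast
      linear_combination hzw t htb
  · obtain ⟨p, hp⟩ := (X.reachable hX x (g • x)).exists_walk_length_eq_dist
    rw [inner_delta, CubeComplex.cocycleRep, mul_apply_eq_comp, permRep_delta,
      ← X.pathOp_eq_cocycle hX (hzw z hz) p, X.pathOp_delta_apply hX z (w z) p hp, hp]


end
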